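/- Let $M$ be a finite simplicial complex and $k\ge 0$ an integer. Recall that: - $M$ is a \emph{combinatorial $d$-manifold} if it has dimension $d$ and the link of each of its vertices is a PL $(d-1)$-sphere, i.e. is PL homeomorphic to the boundary $\partial\Delta^{d}$ of the $d$-simplex (for $d=0$ the $(-1)$-sphere is the complex without nonempty faces); - $M$ is \emph{$(k+1)$-neighborly} if every nonempty set of at most $k+1$ vertices of $M$ is a face of $M$; - for integers $0\le l\le n$, an \emph{$l$-stacked $n$-ball} is a finite simplicial complex whose underlying space is homeomorphic to the closed $n$-ball and which has no interior $j$-faces with $0\le j\le n-1-l$, where a face is interior if it is not contained in the boundary of the ball (for $l=n$ there is no condition on the interior faces); an \emph{$l$-stacked $(n-1)$-sphere} is the boundary complex of an $l$-stacked $n$-ball; - $\mathcal K^{l}(d)$, $0\le l\le d$, is the family of all finite $d$-dimensional simplicial complexes all of whose vertex links are $l$-stacked $(d-1)$-spheres. Then the following holds. 1. If $d\ge 2k$ and $M$ is a $(k+1)$-neighborly combinatorial $d$-manifold, then $M\in\mathcal K^{d-k}(d)$, i.e. every vertex link of $M$ is a $(d-k)$-stacked $(d-1)$-sphere. 2. In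 particular, if $M$ is a $(k+1)$-neighborly combinatorial $2k$-manifold, then $M\in\mathcal K^{k}(2k)$. -/

import Mathlib

universe u v

namespace PreAbstractSimplicialComplex

/-- The closed geometric cell spanned by the vertex set `F`, in barycentric coordinates. -/
def cell {V : Type u} (F : Finset V) : Set (V → ℝ) :=
  {x | (∀ w, 0 ≤ x w) ∧ (∀ w, w ∉ F → x w = 0) ∧ ∑ w ∈ F, x w = 1}

/-- The underlying polyhedron `|K|` of a simplicial complex. It is used for finite complexes,
for which the topology inherited from `V → ℝ` is the usual one. -/
def realization {V : Type u} (K : PreAbstractSimplicialComplex V) : Set (V → ℝ) :=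
  ⋃ F ∈ K.faces, cell F

/-- The link of the vertex `a`: all nonempty `F` with `a ∉ F` and `F ∪ {a} ∈ K`. -/
def link {V : Type u} (K : PreAbstractSimplicialComplex V) (a : V) :
    PreAbstractSimplicialComplex V where
  faces := {F | F.Nonempty ∧ ∃ ha : a ∉ F, F.cons a ha ∈ K.faces}
  isRelLowerSet_faces := by
    rintro F ⟨hF, ha, hK⟩
    refine ⟨hF, fun G hGF hG => ⟨hG, fun h => ha (hGF h), ?_⟩⟩
    exact (K.isRelLowerSet_faces hK).2 (Finset.cons_subset_cons.2 hGF) (Finset.cons_nonempty _)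

/-- The boundary complex `∂Δ^d` of the `d`-simplex with vertices `0, …, d`.
For `d = 0` it has no faces, which is the sphere of dimension `-1`. -/
def simplexBoundary (d : ℕ) : PreAbstractSimplicialComplex (Fin (d + 1)) where
  faces := {F | F.Nonempty ∧ F ≠ Finset.univ}
  isRelLowerSet_faces := by
    rintro F ⟨hF, hne⟩
    exact ⟨hF, fun G hGF hG => ⟨hG, fun h => hne (Finset.univ_subset_iff.1 (h ▸ hGF))⟩⟩

/-- `K` and `L` are PL homeomorphic: there are a homeomorphism `f : |K| → |L|` and a finite
simplicial subdivision `K'` of `|K|` such that `f` is affine on each simplex of `K'`. -/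
def IsPLHomeomorphic {V : Type u} {W : Type v} (K : PreAbstractSimplicialComplex V)
    (L : PreAbstractSimplicialComplex W) : Prop :=
  ∃ (f : K.realization ≃ₜ L.realization) (K' : Geometry.SimplicialComplex ℝ (V → ℝ)),
    K'.faces.Finite ∧
    K'.space = K.realization ∧
    (∀ s ∈ K'.faces, ∃ F ∈ K.faces, convexHull ℝ (s : Set (V → ℝ)) ⊆ cell F) ∧
    ∀ s ∈ K'.faces, ∃ A : (V → ℝ) →ᵃ[ℝ] (W → ℝ),
      ∀ x : K.realization, (x : V → ℝ) ∈ convexHull ℝ (s : Set (V → ℝ)) →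
        (f x : W → ℝ) = A (x : V → ℝ)

/-- `K` has dimension `d` (a `j`-dimensional face has `j + 1` vertices). -/
def HasDimension {V : Type u} (K : PreAbstractSimplicialComplex V) (d : ℕ) : Prop :=
  (∀ F ∈ K.faces, F.card ≤ d + 1) ∧ ∃ F ∈ K.faces, F.card = d + 1

/-- `M` is a combinatorial `d`-manifold: a finite `d`-dimensional simplicial complex all of whose
vertex links are PL `(d - 1)`-spheres, that is, PL homeomorphic to `∂Δ^d`. -/
def IsCombinatorialManifold {V : Type u} (M : PreAbstractSimplicialComplex V) (d : ℕ) : Prop :=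
  M.faces.Finite ∧ M.HasDimension d ∧
    ∀ a : V, {a} ∈ M.faces → (M.link a).IsPLHomeomorphic (simplexBoundary d)

/-- `M` is `m`-neighborly: any at most `m` vertices of `M` span a face, that is, `M` contains the
full `(m - 1)`-skeleton of the simplex on its vertices. -/
def IsNeighborly {V : Type u} (M : PreAbstractSimplicialComplex V) (m : ℕ) : Prop :=
  ∀ F : Finset V, F.Nonempty → F.card ≤ m → (∀ a ∈ F, {a} ∈ M.faces) → F ∈ M.faces

/-- The boundary complex of a triangulated `n`-ball `B`: the faces that lie in the boundary of
the ball `|B|`, i.e. that a homeomorphism `h` from `|B|` onto the closed unit ball of `ℝⁿ` maps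
into the unit sphere. By invariance of domain it does not depend on `h`. -/
def ballBoundary {W : Type u} (B : PreAbstractSimplicialComplex W) {n : ℕ}
    (h : B.realization ≃ₜ Metric.closedBall (0 : EuclideanSpace ℝ (Fin n)) 1) :
    PreAbstractSimplicialComplex W where
  faces := {F | F ∈ B.faces ∧ ∀ x : B.realization, (x : W → ℝ) ∈ cell F →
    (h x : EuclideanSpace ℝ (Fin n)) ∈ Metric.sphere (0 : EuclideanSpace ℝ (Fin n)) 1}
  isRelLowerSet_faces := by
    rintro F ⟨hF, hx⟩
    refine ⟨(B.isRelLowerSet_faces hF).1, fun G hGF hG =>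
      ⟨(B.isRelLowerSet_faces hF).2 hGF hG, fun x hxG => hx x ⟨hxG.1, ?_, ?_⟩⟩⟩
    · exact fun w hw => hxG.2.1 w fun hwG => hw (hGF hwG)
    · rw [← Finset.sum_subset hGF fun w _ hw => hxG.2.1 w hw]
      exact hxG.2.2

/-- `S` is a `k`-stacked `(n - 1)`-sphere: the boundary of a `k`-stacked `n`-ball `B`, which is a
finite complex `B`, triangulating the `n`-ball, without interior `j`-faces for
`0 ≤ j ≤ (n - 1) - k` (a face with `F.card = j + 1` satisfies this iff `F.card + k ≤ n`).
The ball may have vertices outside `V`, so `V` is embedded in the vertex type of `B`. -/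
def IsStackedSphere {V : Type u} (S : PreAbstractSimplicialComplex V) (k n : ℕ) : Prop :=
  ∃ (W : Type u) (e : V ↪ W) (B : PreAbstractSimplicialComplex W)
    (h : B.realization ≃ₜ Metric.closedBall (0 : EuclideanSpace ℝ (Fin n)) 1),
    B.faces.Finite ∧
    (∀ F ∈ B.faces, F.card + k ≤ n → F ∈ (B.ballBoundary h).faces) ∧
    (B.ballBoundary h).faces = Finset.map e '' S.faces

/-- The class `𝒦ᵏ(d)`: finite `d`-dimensional simplicial complexes all of whose vertex links are
`k`-stacked `(d - 1)`-spheres. -/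
def InClassK {V : Type u} (M : PreAbstractSimplicialComplex V) (k d : ℕ) : Prop :=
  M.faces.Finite ∧ M.HasDimension d ∧
    ∀ a : V, {a} ∈ M.faces → (M.link a).IsStackedSphere k d

end PreAbstractSimplicialComplex

/-! Every vertex link `S` of `M` is a PL `(d-1)`-sphere, and it is `k`-neighborly because adding the
vertex to a face of `M.link a` gives a face of `M`. For `d > 0` choose a vertex `v` of `S`, and let
`B` be the cone with apex `v` over the antistar of `v`. The antistar is a `(d-1)`-ball bounded by
the link of `v`, so `B` is a `d`-ball whose boundary is the antistar together with the star of `v`,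
that is, `S`. No new vertices appear, so every face of `B` with at most `k` vertices is a face of
`S`, hence a boundary face. This is `(d-k)`-stackedness.

The substance is that the antistar is a ball. Spheres are replaced by cones: a PL sphere becomes a
complex `Δ` whose `cone Δ` is carried onto `ℝⁿ` by a homogeneous PL chart
(`isLinearSphere_of_isPLHomeomorphic`). Differentiating the chart along the ray through `v` gives a
homeomorphism from `tangent Δ v`, which is `cone (lk Δ v) × ℝ`, onto `ℝⁿ`. Dividing out the ray
makes links into linear spheres again (`IsLinearSphere.link`). Composing with the inverse chart maps
the tangent cone onto `cone Δ`, and this map is the identity near the ray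
(`IsLinearSphere.exists_tangentIso`).

By induction on the dimension this becomes a homeomorphism that is the identity on the whole star of
`v` (`IsLinearSphere.exists_starIso`): homeomorphisms of `cone Δ`, built from the links of the other
vertices, push the star into the region near the ray. The rest of `cone Δ`, the cone over the
antistar, then corresponds to the half of `cone (lk Δ v) × ℝ` with nonpositive last coordinate, a
half-space with boundary `cone (lk Δ v)` (`IsLinearSphere.exists_antistarIso`). Cutting it off at
coordinate sum `1` gives a half-ball that parametrizes `B`. -/

namespace SimplicialCone

open Set Filter Topology

/-- `A` is a closed subset of a vector space that is stable under nonnegative dilations. -/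
structure IsClosedCone {E : Type*} [NormedAddCommGroup E] [NormedSpace ℝ E] (A : Set E) :
    Prop where
  isClosed : IsClosed A
  smul_mem : ∀ x ∈ A, ∀ t : ℝ, 0 ≤ t → t • x ∈ A

/-- `f` restricts to a continuous, positively homogeneous bijection from `A` onto `B`. -/
structure IsConeIso {E F : Type*} [NormedAddCommGroup E] [NormedSpace ℝ E]
    [NormedAddCommGroup F] [NormedSpace ℝ F] (f : E → F) (A : Set E) (B : Set F) : Prop where
  continuousOn : ContinuousOn f A
  bijOn : BijOn f A B
  map_smul : ∀ x ∈ A, ∀ t : ℝ, 0 ≤ t → f (t • x) = t • f x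

/-! ### Homogeneous homeomorphisms between closed cones -/

section ConeIso

variable {E F G : Type*} [NormedAddCommGroup E] [NormedSpace ℝ E]
  [NormedAddCommGroup F] [NormedSpace ℝ F] [NormedAddCommGroup G] [NormedSpace ℝ G]
  {f : E → F} {g : F → G} {A : Set E} {B : Set F} {C : Set G}

theorem IsClosedCone.zero_mem (hA : IsClosedCone A) {x : E} (hx : x ∈ A) : (0 : E) ∈ A := by
  simpa using hA.smul_mem x hx 0 le_rfl

theorem isConeIso_id : IsConeIso (id : E → E) A A :=
  ⟨continuousOn_id, bijOn_id A, by simp⟩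

theorem IsConeIso.comp (hg : IsConeIso g B C) (hf : IsConeIso f A B) : IsConeIso (g ∘ f) A C where
  continuousOn := hg.continuousOn.comp hf.continuousOn hf.bijOn.mapsTo
  bijOn := hg.bijOn.comp hf.bijOn
  map_smul x hx t ht := by
    simp only [Function.comp_apply]
    rw [hf.map_smul x hx t ht, hg.map_smul _ (hf.bijOn.mapsTo hx) t ht]

theorem IsConeIso.map_zero (hf : IsConeIso f A B) {x : E} (hx : x ∈ A) : f 0 = 0 := by
  simpa using hf.map_smul x hx 0 le_rfl

/-- By injectivity and compactness, `‖f‖` has a positive lower bound on the unit vectors of `A`;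
homogeneity does the rest. -/
theorem IsConeIso.exists_norm_le [FiniteDimensional ℝ E] (hA : IsClosedCone A)
    (hf : IsConeIso f A B) : ∃ c : ℝ, 0 ≤ c ∧ ∀ x ∈ A, ‖x‖ ≤ c * ‖f x‖ := by
  have : ProperSpace E := FiniteDimensional.proper ℝ E
  have hK : IsCompact (A ∩ Metric.sphere 0 1) := (isCompact_sphere 0 1).inter_left hA.isClosed
  have key : ∃ m : ℝ, 0 < m ∧ ∀ x ∈ A ∩ Metric.sphere 0 1, m ≤ ‖f x‖ := by
    refine hK.exists_forall_le' (hf.continuousOn.norm.mono inter_subset_left) fun x hx => ?_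
    rw [norm_pos_iff]
    intro h0
    have : x = 0 := hf.bijOn.injOn hx.1 (hA.zero_mem hx.1) (by rw [h0, hf.map_zero hx.1])
    have h1 := hx.2
    simp [this] at h1
  obtain ⟨m, hm, h⟩ := key
  refine ⟨m⁻¹, by positivity, fun x hx => ?_⟩
  rcases eq_or_ne x 0 with rfl | hx0
  · simp only [norm_zero]; positivity
  have hn : 0 < ‖x‖ := norm_pos_iff.2 hx0
  have h1 := h (‖x‖⁻¹ • x) ⟨hA.smul_mem x hx _ (by positivity), by
    simp [norm_smul, hn.ne']⟩
  rw [hf.map_smul x hx _ (by positivity), norm_smul, norm_inv, norm_norm] at h1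
  rw [inv_mul_eq_div, le_div_iff₀ hm]
  rw [inv_mul_eq_div, le_div_iff₀ hn] at h1
  linarith

/-- The linear bound keeps preimages of points near `y` in a compact part of `A`. Each of their
cluster points is mapped to `y`, so by injectivity there is only one. -/
theorem IsConeIso.symm [FiniteDimensional ℝ E] (hA : IsClosedCone A) (hf : IsConeIso f A B) :
    IsConeIso (Function.invFunOn f A) B A := by
  have hinv : ∀ y ∈ B, Function.invFunOn f A y ∈ A ∧ f (Function.invFunOn f A y) = y := by
    intro y hy
    obtain ⟨x, hx, rfl⟩ := hf.bijOn.surjOn hy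
    exact ⟨Function.invFunOn_mem ⟨x, hx, rfl⟩, Function.invFunOn_eq ⟨x, hx, rfl⟩⟩
  refine ⟨?_, ⟨fun y hy => (hinv y hy).1, ?_, ?_⟩, ?_⟩
  · intro y hy
    have : ProperSpace E := FiniteDimensional.proper ℝ E
    obtain ⟨c, hc, hbound⟩ := hf.exists_norm_le hA
    have hK : IsCompact (A ∩ Metric.closedBall 0 (c * (‖y‖ + 1))) :=
      (isCompact_closedBall 0 _).inter_left hA.isClosed
    refine hK.tendsto_nhds_of_unique_mapClusterPt ?_ ?_
    · have h1 : ∀ᶠ z in 𝓝[B] y, ‖z‖ < ‖y‖ + 1 :=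
        (continuous_norm.continuousAt.eventually_lt continuousAt_const (by simp)).filter_mono
          nhdsWithin_le_nhds
      filter_upwards [h1, self_mem_nhdsWithin] with z hz hzB
      obtain ⟨h2, h3⟩ := hinv z hzB
      refine ⟨h2, ?_⟩
      rw [mem_closedBall_zero_iff]
      calc _ ≤ c * ‖f (Function.invFunOn f A z)‖ := hbound _ h2
        _ ≤ _ := by rw [h3]; gcongr
    · rintro x ⟨hxA, -⟩ hx
      obtain ⟨h2, h3⟩ := hinv y hy
      refine hf.bijOn.injOn hxA h2 ?_
      rw [h3]
      obtain ⟨u, hu, hux⟩ := mapClusterPt_iff_ultrafilter.1 hx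
      have huB : ∀ᶠ z in (u : Filter F), z ∈ B := hu self_mem_nhdsWithin
      have h4 : Tendsto (fun z => f (Function.invFunOn f A z)) u (𝓝 (f x)) :=
        (hf.continuousOn x hxA).tendsto.comp (tendsto_nhdsWithin_iff.2
          ⟨hux, huB.mono fun z hz => (hinv z hz).1⟩)
      have h5 : Tendsto (fun z => f (Function.invFunOn f A z)) u (𝓝 y) := by
        refine Tendsto.congr' (f₁ := id) ?_ (hu.trans nhdsWithin_le_nhds)
        filter_upwards [huB] with z hz
        exact (hinv z hz).2.symm
      exact tendsto_nhds_unique h4 h5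
  · intro y hy z hz h
    rw [← (hinv y hy).2, ← (hinv z hz).2, h]
  · intro x hx
    have hy := hf.bijOn.mapsTo hx
    exact ⟨f x, hy, hf.bijOn.injOn (hinv _ hy).1 hx (hinv _ hy).2⟩
  · intro y hy t ht
    obtain ⟨h2, h3⟩ := hinv y hy
    have h4 := hA.smul_mem _ h2 t ht
    have h5 : t • y ∈ B := by
      have := hf.bijOn.mapsTo h4
      rwa [hf.map_smul _ h2 t ht, h3] at this
    obtain ⟨h6, h7⟩ := hinv _ h5
    refine hf.bijOn.injOn h6 h4 ?_
    rw [h7, hf.map_smul _ h2 t ht, h3]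

end ConeIso

/-! ### Cones over complexes and tangent cones at a vertex -/

section Cone

variable {U : Type*}

/-- The cone spanned by a family of finite sets: the nonnegative vectors supported on a member. -/
def cone (Δ : Set (Finset U)) : Set (U → ℝ) :=
  {x | (∀ w, 0 ≤ x w) ∧ ∃ F ∈ Δ, ∀ w, w ∉ F → x w = 0}

theorem isClosedCone_cone [Fintype U] (Δ : Set (Finset U)) : IsClosedCone (cone Δ) := by
  refine ⟨?_, ?_⟩
  · have : cone Δ = (⋂ w, {x : U → ℝ | 0 ≤ x w}) ∩
        ⋃ F ∈ Δ, ⋂ w, {x : U → ℝ | w ∉ F → x w = 0} := by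
      ext x; simp [cone]
    rw [this]
    refine IsClosed.inter (isClosed_iInter fun w => isClosed_le continuous_const
      (continuous_apply w)) (Δ.toFinite.isClosed_biUnion fun F _ => isClosed_iInter fun w => ?_)
    by_cases hw : w ∈ F
    · simp [hw]
    · simpa [hw] using isClosed_eq (continuous_apply w) continuous_const
  · rintro x ⟨h0, F, hF, h⟩ t ht
    exact ⟨fun w => mul_nonneg ht (h0 w), F, hF, fun w hw => by simp [h w hw]⟩

variable [DecidableEq U]

/-- The link of a vertex, for complexes whose faces include the empty set. -/
def lk (Δ : Set (Finset U)) (v : U) : Set (Finset U) :=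
  {F | v ∉ F ∧ insert v F ∈ Δ}

/-- The tangent cone of `cone Δ` along the ray through the vertex `v`. -/
def tangent (Δ : Set (Finset U)) (v : U) : Set (U → ℝ) :=
  {x | Function.update x v 0 ∈ cone (lk Δ v)}

/-- The sum of all the coordinates except for the one at `v`. -/
def height [Fintype U] (v : U) (x : U → ℝ) : ℝ := ∑ w ∈ Finset.univ.erase v, x w

variable {Δ : Set (Finset U)} {v : U} {x : U → ℝ}

theorem isLowerSet_lk (hΔ : IsLowerSet Δ) : IsLowerSet (lk Δ v) := fun _ _ hGF hF =>
  ⟨fun h => hF.1 (hGF h), hΔ (Finset.insert_subset_insert v hGF) hF.2⟩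

theorem apply_eq_zero_of_mem_cone_lk (hx : x ∈ cone (lk Δ v)) : x v = 0 := by
  obtain ⟨-, F, hF, h⟩ := hx
  exact h v hF.1

theorem mem_tangent_of_mem_cone_lk (hx : x ∈ cone (lk Δ v)) : x ∈ tangent Δ v := by
  have : Function.update x v 0 = x := by
    rw [← apply_eq_zero_of_mem_cone_lk hx, Function.update_eq_self]
  rwa [tangent, mem_ofPred_eq, this]

theorem mem_cone_lk_of_mem_tangent (hx : x ∈ tangent Δ v) (h : x v = 0) : x ∈ cone (lk Δ v) := by
  have : Function.update x v 0 = x := by rw [← h, Function.update_eq_self]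
  rwa [tangent, mem_ofPred_eq, this] at hx

theorem nonneg_of_mem_tangent (hx : x ∈ tangent Δ v) {w : U} (hw : w ≠ v) : 0 ≤ x w := by
  have := hx.1 w
  rwa [Function.update_of_ne hw] at this

theorem mem_tangent_congr {y : U → ℝ} (h : ∀ w, w ≠ v → x w = y w) :
    x ∈ tangent Δ v ↔ y ∈ tangent Δ v := by
  have : Function.update x v 0 = Function.update y v 0 := by
    ext w
    rcases eq_or_ne w v with rfl | hw
    · simp
    · simp [hw, h w hw]
  rw [tangent, mem_ofPred_eq, this, mem_ofPred_eq]

theorem add_single_mem_tangent_iff (s : ℝ) :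
    x + s • Pi.single v (1 : ℝ) ∈ tangent Δ v ↔ x ∈ tangent Δ v :=
  mem_tangent_congr fun w hw => by simp [hw]

theorem mem_cone_of_mem_tangent (hx : x ∈ tangent Δ v) (h : 0 ≤ x v) : x ∈ cone Δ := by
  refine ⟨fun w => ?_, ?_⟩
  · rcases eq_or_ne w v with rfl | hw
    · exact h
    · exact nonneg_of_mem_tangent hx hw
  · obtain ⟨-, F, hF, h0⟩ := hx
    refine ⟨insert v F, hF.2, fun w hw => ?_⟩
    rw [Finset.mem_insert, not_or] at hw
    simpa [hw.1] using h0 w hw.2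

theorem mem_tangent_of_mem_cone (hx : x ∈ cone Δ) (h : 0 < x v) :
    x ∈ tangent Δ v := by
  obtain ⟨h0, F, hF, hxF⟩ := hx
  have hvF : v ∈ F := by
    by_contra hv
    exact h.ne' (hxF v hv)
  refine ⟨fun w => ?_, F.erase v, ⟨by simp, by rwa [Finset.insert_erase hvF]⟩, fun w hw => ?_⟩
  · rcases eq_or_ne w v with rfl | hw
    · simp
    · simpa [hw] using h0 w
  · rcases eq_or_ne w v with rfl | hwv
    · simp
    · simp only [ne_eq, hwv, not_false_eq_true, Function.update_of_ne]
      exact hxF w fun h => hw (Finset.mem_erase.2 ⟨hwv, h⟩)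

theorem single_mem_tangent (hv : {v} ∈ Δ) (s : ℝ) :
    s • Pi.single v (1 : ℝ) ∈ tangent Δ v := by
  have h0 : (0 : U → ℝ) ∈ tangent Δ v :=
    mem_tangent_of_mem_cone_lk ⟨by simp, ∅, ⟨by simp, by simpa using hv⟩, by simp⟩
  simpa using (add_single_mem_tangent_iff s).2 h0

theorem single_mem_cone (hv : {v} ∈ Δ) {s : ℝ} (hs : 0 ≤ s) :
    s • Pi.single v (1 : ℝ) ∈ cone Δ :=
  mem_cone_of_mem_tangent (single_mem_tangent hv s) (by simpa using hs)

variable [Fintype U]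

theorem isClosedCone_tangent (Δ : Set (Finset U)) (v : U) : IsClosedCone (tangent Δ v) := by
  refine ⟨(isClosedCone_cone _).isClosed.preimage (by fun_prop), fun x hx t ht => ?_⟩
  have := (isClosedCone_cone _).smul_mem _ hx t ht
  rw [← Function.update_smul, smul_zero] at this
  exact this

theorem height_nonneg (hx : x ∈ tangent Δ v) : 0 ≤ height v x :=
  Finset.sum_nonneg fun _ hw => nonneg_of_mem_tangent hx (Finset.ne_of_mem_erase hw)

theorem height_congr {y : U → ℝ} (h : ∀ w, w ≠ v → x w = y w) : height v x = height v y :=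
  Finset.sum_congr rfl fun w hw => h w (Finset.ne_of_mem_erase hw)

theorem height_add_single (s : ℝ) : height v (x + s • Pi.single v (1 : ℝ)) = height v x :=
  height_congr fun w hw => by simp [hw]

theorem height_smul (t : ℝ) : height v (t • x) = t * height v x := by
  simp only [height, Pi.smul_apply, smul_eq_mul, Finset.mul_sum]

theorem continuous_height : Continuous (height v : (U → ℝ) → ℝ) := by
  unfold height; fun_prop

theorem eq_smul_single_of_height_eq_zero (hx : x ∈ tangent Δ v) (h : height v x = 0) :
    x = x v • Pi.single v (1 : ℝ) := by
  rw [height, Finset.sum_eq_zero_iff_of_nonneg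
    fun w hw => nonneg_of_mem_tangent hx (Finset.ne_of_mem_erase hw)] at h
  ext w
  rcases eq_or_ne w v with rfl | hw
  · simp
  · simp [hw, h w (Finset.mem_erase.2 ⟨hw, Finset.mem_univ w⟩)]

end Cone

end SimplicialCone

/-! ### Derivative of a PL chart along a ray; links of spheres -/

namespace SimplicialCone

open Set Filter Topology

variable {U : Type*} [DecidableEq U] [Fintype U]

/-- `φ` is a positively homogeneous piecewise linear homeomorphism from `cone Δ` onto `ℝⁿ`. -/
structure IsPLChart (Δ : Set (Finset U)) (n : ℕ) (φ : (U → ℝ) → (Fin n → ℝ)) : Prop where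
  isConeIso : IsConeIso φ (cone Δ) univ
  exists_linear : ∃ 𝒜 : Set ((U → ℝ) →ₗ[ℝ] (Fin n → ℝ)), 𝒜.Finite ∧
    ∀ x ∈ cone Δ, ∃ A ∈ 𝒜, φ x = A x

/-- `Δ` is a complex whose cone is positively homogeneously PL homeomorphic to `ℝⁿ`. -/
structure IsLinearSphere (Δ : Set (Finset U)) (n : ℕ) : Prop where
  isLowerSet : IsLowerSet Δ
  empty_mem : ∅ ∈ Δ
  exists_chart : ∃ φ, IsPLChart Δ n φ

variable {Δ : Set (Finset U)} {v : U} {n : ℕ} {φ : (U → ℝ) → (Fin n → ℝ)}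

/-- Near `Pi.single v 1`, continuity excludes every linear piece that disagrees with `φ` at that
point. Homogeneity spreads this from a neighborhood to a conical region around the ray. -/
theorem IsPLChart.exists_tangent_bound (hφ : IsPLChart Δ n φ) (hv : {v} ∈ Δ) :
    ∃ 𝒜 : Set ((U → ℝ) →ₗ[ℝ] (Fin n → ℝ)), 𝒜.Finite ∧ ∃ c : ℝ, 0 < c ∧
      (∀ x ∈ cone Δ, ∃ A ∈ 𝒜, φ x = A x) ∧
      ∀ x ∈ tangent Δ v, 0 < x v → c * height v x ≤ x v → ∀ A ∈ 𝒜, φ x = A x →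
        A (Pi.single v 1) = φ (Pi.single v 1) := by
  obtain ⟨𝒜, h𝒜, hsel⟩ := hφ.exists_linear
  refine ⟨𝒜, h𝒜, ?_⟩
  set e : U → ℝ := Pi.single v 1 with he
  have heC : e ∈ cone Δ := by simpa using single_mem_cone hv zero_le_one
  have hev : ∀ᶠ z in 𝓝[cone Δ] e, ∀ A ∈ 𝒜, φ z = A z → A e = φ e := by
    rw [h𝒜.eventually_all]
    intro A _
    by_cases hA : A e = φ e
    · exact Eventually.of_forall fun _ _ => hA
    · have hne : ∀ᶠ z in 𝓝[cone Δ] e, φ z - A z ≠ 0 := by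
        refine ((hφ.isConeIso.continuousOn e heC).sub
          A.continuous_of_finiteDimensional.continuousWithinAt).tendsto.eventually_ne ?_
        exact sub_ne_zero.2 (Ne.symm hA)
      filter_upwards [hne] with z hz h
      exact absurd (sub_eq_zero.2 h) hz
  obtain ⟨ε, hε, hball⟩ := Metric.mem_nhdsWithin_iff.1 hev
  -- If `(2 / ε) * height v x ≤ x v`, each coordinate of `x / x v` other than the one at `v` is at
  -- most `ε / 2`, so the rescaled point lies in the `ε`-ball.
  refine ⟨2 / ε, by positivity, hsel, fun x hx hxv hcx A hA hxA => ?_⟩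
  have hxC := mem_cone_of_mem_tangent hx hxv.le
  have hz : (x v)⁻¹ • x ∈ cone Δ := (isClosedCone_cone Δ).smul_mem _ hxC _ (by positivity)
  refine hball ⟨?_, hz⟩ A hA ?_
  · rw [Metric.mem_ball, dist_pi_lt_iff hε]
    intro w
    rcases eq_or_ne w v with rfl | hw
    · simp [he, hxv.ne', hε]
    · have h1 : x w ≤ height v x :=
        Finset.single_le_sum (f := x)
          (fun i hi => nonneg_of_mem_tangent hx (Finset.ne_of_mem_erase hi))
          (Finset.mem_erase.2 ⟨hw, Finset.mem_univ w⟩)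
      have h0 := nonneg_of_mem_tangent hx hw
      have h2 : x w < ε * x v := by
        rw [div_mul_eq_mul_div, div_le_iff₀ hε] at hcx
        nlinarith [mul_pos hxv hε]
      simp only [he, Pi.smul_apply, smul_eq_mul, Pi.single_apply, hw, if_false, Real.dist_eq,
        sub_zero]
      rw [abs_of_nonneg (by positivity), inv_mul_eq_div, div_lt_iff₀ hxv]
      exact h2
  · rw [hφ.isConeIso.map_smul x hxC _ (by positivity), map_smul, hxA]

/-- The derivative of `φ` along the ray through `v`, computed at distance `c`. -/
def derivAlong (φ : (U → ℝ) → (Fin n → ℝ)) (v : U) (c : ℝ) (x : U → ℝ) : Fin n → ℝ :=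
  φ (x + (|x v| + c * height v x) • Pi.single v 1) -
    (|x v| + c * height v x) • φ (Pi.single v 1)

/-- In the region `c * height v x ≤ x v`, moving along the ray changes `φ` by multiples of `φ
(Pi.single v 1)`. Translating a tangent vector into this region and subtracting the corresponding
multiple therefore extends `φ` consistently to the whole tangent cone. -/
theorem IsPLChart.exists_derivAlong (hφ : IsPLChart Δ n φ) (hv : {v} ∈ Δ) :
    ∃ c : ℝ, 0 < c ∧ ∃ ψ : (U → ℝ) → (Fin n → ℝ), IsConeIso ψ (tangent Δ v) univ ∧
      (∃ 𝒜 : Set ((U → ℝ) →ₗ[ℝ] (Fin n → ℝ)), 𝒜.Finite ∧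
        ∀ x ∈ tangent Δ v, ∃ A ∈ 𝒜, ψ x = A x) ∧
      (∀ x ∈ tangent Δ v, c * height v x ≤ x v → ψ x = φ x) ∧
      ∀ x ∈ tangent Δ v, ∀ s : ℝ, ψ (x + s • Pi.single v 1) = ψ x + s • φ (Pi.single v 1) := by
  obtain ⟨𝒜, h𝒜, c, hc, hsel, hbound⟩ := hφ.exists_tangent_bound hv
  set e : U → ℝ := Pi.single v 1 with he
  have hev : e v = 1 := by simp [he]
  have hT : ∀ {x} (s : ℝ), x ∈ tangent Δ v → x + s • e ∈ tangent Δ v :=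
    fun s hx => (add_single_mem_tangent_iff s).2 hx
  have hH : ∀ x (s : ℝ), height v (x + s • e) = height v x := fun x s => height_add_single s
  have hcone : ∀ {x}, x ∈ tangent Δ v → c * height v x ≤ x v → x ∈ cone Δ := fun {x} hx h =>
    mem_cone_of_mem_tangent hx ((mul_nonneg hc.le (height_nonneg hx)).trans h)
  -- translation along the ray
  have hray : ∀ x ∈ tangent Δ v, c * height v x ≤ x v → ∀ s : ℝ, 0 ≤ s →
      φ (x + s • e) = φ x + s • φ e := by
    intro x hx hcx s hs
    have hx0 : 0 ≤ x v := (mul_nonneg hc.le (height_nonneg hx)).trans hcx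
    rcases hx0.eq_or_lt with h0 | hpos
    · have h1 : height v x = 0 := by
        have := height_nonneg hx
        nlinarith
      have h2 : x = 0 := by
        rw [eq_smul_single_of_height_eq_zero hx h1, ← h0, zero_smul]
      have heC : e ∈ cone Δ := by simpa using single_mem_cone hv zero_le_one
      rw [h2, zero_add, hφ.isConeIso.map_zero heC, zero_add, hφ.isConeIso.map_smul e heC s hs]
    · have hmem : ∀ t ∈ Ici (0 : ℝ), x + t • e ∈ tangent Δ v ∧ 0 < (x + t • e) v ∧
          c * height v (x + t • e) ≤ (x + t • e) v := by
        intro t ht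
        have ht' : (0 : ℝ) ≤ t := ht
        refine ⟨hT t hx, ?_, ?_⟩
        · simp [hev]; positivity
        · rw [hH]; simp [hev]; linarith
      -- `g` is continuous, and its values lie among the finitely many `A x` with `A ∈ 𝒜`; on a
      -- connected half-line it is constant.
      let g : ℝ → (Fin n → ℝ) := fun t => φ (x + t • e) - t • φ e
      have hg : ContinuousOn g (Ici 0) := by
        refine ContinuousOn.sub (hφ.isConeIso.continuousOn.comp (by fun_prop) ?_) (by fun_prop)
        intro t ht
        exact hcone (hmem t ht).1 (hmem t ht).2.2
      have hfin : (g '' Ici 0).Finite := by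
        refine (h𝒜.image fun A => A x).subset ?_
        rintro _ ⟨t, ht, rfl⟩
        obtain ⟨h1, h2, h3⟩ := hmem t ht
        obtain ⟨A, hA, hAx⟩ := hsel _ (hcone h1 h3)
        refine ⟨A, hA, ?_⟩
        have := hbound _ h1 h2 h3 A hA hAx
        simp only [g]
        rw [hAx, map_add, map_smul, this, add_sub_cancel_right]
      have hsub := hfin.countable.isTotallyDisconnected _ Subset.rfl
        (isPreconnected_Ici.image g hg)
      have := hsub (mem_image_of_mem g (mem_Ici.2 hs)) (mem_image_of_mem g (mem_Ici.2 le_rfl))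
      simp only [g, zero_smul, add_zero, sub_zero] at this
      rw [← this, sub_add_cancel]
  have hindep : ∀ x ∈ tangent Δ v, ∀ s t : ℝ, c * height v x ≤ x v + s →
      c * height v x ≤ x v + t → φ (x + s • e) - s • φ e = φ (x + t • e) - t • φ e := by
    have haux : ∀ x ∈ tangent Δ v, ∀ s t : ℝ, c * height v x ≤ x v + s → s ≤ t →
        φ (x + s • e) - s • φ e = φ (x + t • e) - t • φ e := by
      intro x hx s t h1 h2
      have := hray (x + s • e) (hT s hx) (by rw [hH]; simpa [hev] using h1) (t - s)
        (sub_nonneg.2 h2)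
      rw [add_assoc, ← add_smul, add_sub_cancel, sub_smul] at this
      rw [this]; abel
    intro x hx s t h1 h2
    rcases le_total s t with h | h
    · exact haux x hx s t h1 h
    · exact (haux x hx t s h2 h).symm
  have hN : ∀ x ∈ tangent Δ v, c * height v x ≤ x v + (|x v| + c * height v x) := by
    intro x _
    linarith [neg_abs_le (x v)]
  have hψ : ∀ x ∈ tangent Δ v, ∀ s : ℝ, c * height v x ≤ x v + s →
      derivAlong φ v c x = φ (x + s • e) - s • φ e :=
    fun x hx s hs => hindep x hx _ s (hN x hx) hs
  refine ⟨c, hc, derivAlong φ v c, ⟨?_, ⟨mapsTo_univ _ _, ?_, ?_⟩, ?_⟩, ⟨𝒜, h𝒜, ?_⟩, ?_, ?_⟩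
  · have hh : Continuous (height v : (U → ℝ) → ℝ) := continuous_height
    unfold derivAlong
    refine ContinuousOn.sub (hφ.isConeIso.continuousOn.comp (by fun_prop) ?_) (by fun_prop)
    intro x hx
    refine hcone (hT _ hx) ?_
    rw [hH]
    simpa using hN x hx
  · intro x hx y hy hxy
    -- A common translation brings both points into the region where `φ` is injective.
    let N := max (|x v| + c * height v x) (|y v| + c * height v y)
    have h1 : c * height v x ≤ x v + N := (hN x hx).trans (by gcongr; exact le_max_left _ _)
    have h2 : c * height v y ≤ y v + N := (hN y hy).trans (by gcongr; exact le_max_right _ _)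
    rw [hψ x hx N h1, hψ y hy N h2, sub_left_inj] at hxy
    have := hφ.isConeIso.bijOn.injOn
      (hcone (hT N hx) (by rw [hH]; simpa [hev] using h1))
      (hcone (hT N hy) (by rw [hH]; simpa [hev] using h2)) hxy
    exact add_right_cancel this
  · intro η _
    have hinv := hφ.isConeIso.symm (isClosedCone_cone Δ)
    set f := Function.invFunOn φ (cone Δ) with hf
    have heC : e ∈ cone Δ := by simpa using single_mem_cone hv zero_le_one
    have hfe : f (φ e) = e := hφ.isConeIso.bijOn.injOn.leftInvOn_invFunOn heC
    have hφf : ∀ y, φ (f y) = y := fun y => Function.invFunOn_eq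
      (hφ.isConeIso.bijOn.surjOn (mem_univ y))
    have hcont : Continuous f := continuousOn_univ.1 hinv.continuousOn
    -- For small `t > 0` the preimage `z` of `φ e + t • η` is close to `e`, hence in the good
    -- region; the difference quotient `(z - e) / t` is the preimage of `η`.
    have hlim : Tendsto (fun t : ℝ => f (φ e + t • η)) (𝓝 0) (𝓝 e) := by
      have : Continuous fun t : ℝ => f (φ e + t • η) := by fun_prop
      simpa [hfe] using this.tendsto 0
    have hopen : ∀ᶠ z in 𝓝 e, 0 < z v ∧ c * height v z < z v := by
      have h1 : Continuous fun z : U → ℝ => z v := continuous_apply v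
      have h2 : Continuous fun z : U → ℝ => c * height v z := continuous_const.mul continuous_height
      have h3 : height v e = 0 := by
        refine Finset.sum_eq_zero fun w hw => ?_
        simp [he, Finset.ne_of_mem_erase hw]
      refine (continuousAt_const.eventually_lt h1.continuousAt (by simp [hev])).and
        (h2.continuousAt.eventually_lt h1.continuousAt (by simp [hev, h3]))
    have hpos : ∀ᶠ t : ℝ in 𝓝[>] 0, 0 < t := self_mem_nhdsWithin
    obtain ⟨t, ⟨hz0, hzh⟩, ht⟩ :=
      (((hlim.eventually hopen).filter_mono nhdsWithin_le_nhds).and hpos).exists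
    set z := f (φ e + t • η) with hz
    have hzC : z ∈ cone Δ := hinv.bijOn.mapsTo (mem_univ _)
    have hzT := mem_tangent_of_mem_cone hzC hz0
    have hzT' := (isClosedCone_tangent Δ v).smul_mem z hzT t⁻¹ (by positivity)
    have hx : t⁻¹ • z + (-t⁻¹) • e ∈ tangent Δ v := hT _ hzT'
    refine ⟨_, hx, ?_⟩
    rw [hψ _ hx t⁻¹ ?_]
    · rw [neg_smul, neg_add_cancel_right, hφ.isConeIso.map_smul z hzC _ (by positivity), hz, hφf,
        smul_add, smul_smul, inv_mul_cancel₀ ht.ne', one_smul, add_sub_cancel_left]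
    · rw [hH, height_smul]
      simp only [Pi.add_apply, Pi.smul_apply, smul_eq_mul, hev]
      have : 0 < t⁻¹ := by positivity
      nlinarith
  · intro x hx t ht
    have hm := (isClosedCone_tangent Δ v).smul_mem x hx t ht
    have hN' := hN x hx
    rw [hψ (t • x) hm (t * (|x v| + c * height v x)) ?_, hψ x hx _ hN', mul_smul, ← smul_add,
      hφ.isConeIso.map_smul _ (hcone (hT _ hx) (by rw [hH]; simpa [hev] using hN')) t ht,
      mul_smul, smul_sub]
    rw [height_smul, Pi.smul_apply, smul_eq_mul]
    nlinarith
  · intro x hx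
    have hN' := hN x hx
    have hx' := hT (|x v| + c * height v x + 1) hx
    have h3 : c * height v (x + (|x v| + c * height v x + 1) • e) ≤
        (x + (|x v| + c * height v x + 1) • e) v := by
      rw [hH]
      simp only [Pi.add_apply, Pi.smul_apply, smul_eq_mul, hev]
      linarith
    obtain ⟨A, hA, hAx⟩ := hsel _ (hcone hx' h3)
    refine ⟨A, hA, ?_⟩
    have h4 : 0 < (x + (|x v| + c * height v x + 1) • e) v := by
      have := mul_nonneg hc.le (height_nonneg hx)
      simp only [Pi.add_apply, Pi.smul_apply, smul_eq_mul, hev]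
      linarith [neg_abs_le (x v)]
    rw [hψ x hx (|x v| + c * height v x + 1) (by linarith), hAx, map_add, map_smul,
      hbound _ hx' h4 h3 A hA hAx, add_sub_cancel_right]
  · intro x hx h
    rw [hψ x hx 0 (by simpa using h)]
    simp
  · intro x hx s
    have h1 := hN x hx
    set N := |x v| + c * height v x
    rw [hψ (x + s • e) (hT s hx) (N - s) ?_, hψ x hx N h1, add_assoc, ← add_smul,
      add_sub_cancel, sub_smul]
    · abel
    · rw [hH]; simp [hev]; linarith

theorem exists_linearMap_ker_eq_span {n : ℕ} {p : Fin (n + 1) → ℝ} (hp : p ≠ 0) :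
    ∃ π : (Fin (n + 1) → ℝ) →ₗ[ℝ] (Fin n → ℝ), Function.Surjective π ∧
      ∀ x, π x = 0 ↔ ∃ s : ℝ, x = s • p := by
  have h1 : Module.finrank ℝ ((Fin (n + 1) → ℝ) ⧸ (ℝ ∙ p)) = Module.finrank ℝ (Fin n → ℝ) := by
    have := Submodule.finrank_quotient_add_finrank (ℝ ∙ p)
    rw [finrank_span_singleton hp] at this
    simp at this ⊢
    omega
  let ι := LinearEquiv.ofFinrankEq _ _ h1
  refine ⟨ι.toLinearMap ∘ₗ (ℝ ∙ p).mkQ, ι.surjective.comp (Submodule.mkQ_surjective _),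
    fun x => ?_⟩
  rw [LinearMap.comp_apply, LinearEquiv.coe_coe, LinearEquiv.map_eq_zero_iff, Submodule.mkQ_apply,
    Submodule.Quotient.mk_eq_zero, Submodule.mem_span_singleton]
  simp only [eq_comm]

/-- The derivative `ψ` turns translation along the ray into translation by `φ (Pi.single v 1)`.
Dividing by both lines identifies `cone (lk Δ v)`, the slice `x v = 0`, with `ℝⁿ`. -/
theorem IsLinearSphere.link (h : IsLinearSphere Δ (n + 1)) (hv : {v} ∈ Δ) :
    IsLinearSphere (lk Δ v) n := by
  obtain ⟨hΔ, -, φ, hφ⟩ := h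
  refine ⟨isLowerSet_lk hΔ, ⟨by simp, by simpa using hv⟩, ?_⟩
  obtain ⟨c, -, ψ, hψ, ⟨𝒜, h𝒜, hsel⟩, -, htr⟩ := hφ.exists_derivAlong hv
  have heC : (Pi.single v 1 : U → ℝ) ∈ cone Δ := by simpa using single_mem_cone hv zero_le_one
  have hp : φ (Pi.single v 1) ≠ 0 := by
    intro h0
    have := hφ.isConeIso.bijOn.injOn heC ((isClosedCone_cone Δ).zero_mem heC)
      (by rw [h0, hφ.isConeIso.map_zero heC])
    have := congrFun this v
    simp at this
  obtain ⟨π, hsurj, hker⟩ := exists_linearMap_ker_eq_span hp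
  refine ⟨fun x => π (ψ x), ⟨?_, ⟨mapsTo_univ _ _, ?_, ?_⟩, ?_⟩,
    (fun A => π ∘ₗ A) '' 𝒜, h𝒜.image _, fun x hx => ?_⟩
  · exact π.continuous_of_finiteDimensional.comp_continuousOn
      (hψ.continuousOn.mono fun x => mem_tangent_of_mem_cone_lk)
  · intro x hx y hy hxy
    have h1 : π (ψ x - ψ y) = 0 := by rw [map_sub]; exact sub_eq_zero.2 hxy
    obtain ⟨s, hs⟩ := (hker _).1 h1
    have hyT := mem_tangent_of_mem_cone_lk hy
    have h2 : ψ x = ψ (y + s • Pi.single v 1) := by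
      rw [htr y hyT, ← hs]; abel
    have h3 := hψ.bijOn.injOn (mem_tangent_of_mem_cone_lk hx)
      ((add_single_mem_tangent_iff s).2 hyT) h2
    have h4 := congrFun h3 v
    simp [apply_eq_zero_of_mem_cone_lk hx, apply_eq_zero_of_mem_cone_lk hy] at h4
    simpa [← h4] using h3
  · intro η _
    obtain ⟨y, rfl⟩ := hsurj η
    obtain ⟨x, hx, rfl⟩ := hψ.bijOn.surjOn (mem_univ y)
    refine ⟨x + (-x v) • Pi.single v 1, mem_cone_lk_of_mem_tangent
      ((add_single_mem_tangent_iff _).2 hx) (by simp), ?_⟩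
    beta_reduce
    rw [htr x hx, map_add, (hker _).2 ⟨_, rfl⟩, add_zero]
  · intro x hx t ht
    rw [hψ.map_smul x (mem_tangent_of_mem_cone_lk hx) t ht, map_smul]
  · obtain ⟨A, hA, h⟩ := hsel x (mem_tangent_of_mem_cone_lk hx)
    exact ⟨_, mem_image_of_mem _ hA, by simp [h]⟩

/-- The map is the derivative followed by the inverse chart; near the ray the derivative equals `φ`.
-/
theorem IsLinearSphere.exists_tangentIso (h : IsLinearSphere Δ n) (hv : {v} ∈ Δ) :
    ∃ c : ℝ, 0 < c ∧ ∃ Φ : (U → ℝ) → (U → ℝ), IsConeIso Φ (tangent Δ v) (cone Δ) ∧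
      ∀ x ∈ tangent Δ v, c * height v x ≤ x v → Φ x = x := by
  obtain ⟨-, -, φ, hφ⟩ := h
  obtain ⟨c, hc, ψ, hψ, -, heq, -⟩ := hφ.exists_derivAlong hv
  refine ⟨c, hc, _, (hφ.isConeIso.symm (isClosedCone_cone Δ)).comp hψ, fun x hx h => ?_⟩
  rw [Function.comp_apply, heq x hx h]
  exact hφ.isConeIso.bijOn.injOn.leftInvOn_invFunOn
    (mem_cone_of_mem_tangent hx ((mul_nonneg hc.le (height_nonneg hx)).trans h))

end SimplicialCone

/-! ### Making the tangent isomorphism the identity on the star -/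

namespace SimplicialCone

open Set Filter Topology

variable {U : Type*} [DecidableEq U] {Δ : Set (Finset U)} {v x : U} {n : ℕ}

theorem update_zero_add_single (z : U → ℝ) (x : U) :
    Function.update z x 0 + z x • Pi.single x (1 : ℝ) = z := by
  ext w
  rcases eq_or_ne w x with rfl | hw
  · simp
  · simp [hw]

theorem exists_face_of_mem_tangent {z : U → ℝ} (hxv : x ≠ v) (hz : z ∈ tangent Δ v)
    (hzx : z x ≠ 0) : ∃ F, v ∉ F ∧ insert v F ∈ Δ ∧ x ∈ F ∧
      ∀ w, w ∉ F → Function.update z v 0 w = 0 := by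
  obtain ⟨-, F, hF, h⟩ := hz
  refine ⟨F, hF.1, hF.2, ?_, h⟩
  by_contra hx
  have := h x hx
  rw [Function.update_of_ne hxv] at this
  exact hzx this

theorem singleton_mem_lk (hΔ : IsLowerSet Δ) {z : U → ℝ} (hxv : x ≠ v) (hz : z ∈ tangent Δ v)
    (hzx : z x ≠ 0) : {v} ∈ lk Δ x := by
  obtain ⟨F, -, hF, hxF, -⟩ := exists_face_of_mem_tangent hxv hz hzx
  refine ⟨by simpa using hxv, hΔ ?_ hF⟩
  intro w hw
  simp only [Finset.mem_insert, Finset.mem_singleton] at hw ⊢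
  exact hw.elim (fun h => Or.inr (h ▸ hxF)) Or.inl

theorem update_zero_mem_tangent_lk {z : U → ℝ} (hxv : x ≠ v)
    (hz : z ∈ tangent Δ v) (hzx : z x ≠ 0) :
    Function.update z x 0 ∈ tangent (lk Δ x) v := by
  obtain ⟨F, hvF, hF, hxF, h⟩ := exists_face_of_mem_tangent hxv hz hzx
  refine ⟨fun w => ?_, F.erase x, ⟨fun hv => hvF (Finset.mem_of_mem_erase hv), ?_, ?_⟩,
    fun w hw => ?_⟩
  · have := hz.1 w
    by_cases hw : w = x <;> by_cases hw' : w = v <;> simp_all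
  · simp [hxv]
  · rwa [Finset.insert_comm, Finset.insert_erase hxF]
  · rw [Finset.mem_erase, not_and] at hw
    have := h w
    by_cases hw2 : w = x <;> by_cases hw' : w = v <;> simp_all

variable [Fintype U]

open Classical in
-- On the star of `x`, `ω` replaces `cone (lk Δ x)` by `tangent (lk Δ x) v`, where translation along
-- `v` is available. Translating by `c * z x` is trivial where `z x = 0`, so it glues with the
-- identity outside the star. Where `z v ≥ 0`, `ω` is the identity and the translation is visible
-- unchanged.
theorem exists_push (hxv : x ≠ v) {ω : (U → ℝ) → (U → ℝ)}
    (hω : IsConeIso ω (tangent (lk Δ x) v) (cone (lk Δ x)))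
    (hid : ∀ u ∈ tangent (lk Δ x) v, 0 ≤ u v → ω u = u) {c : ℝ} (hc : 0 ≤ c) :
    ∃ h : (U → ℝ) → (U → ℝ), IsConeIso h (cone Δ) (cone Δ) ∧
      ∀ z ∈ tangent Δ v, 0 ≤ z v → h z = z + (c * z x) • Pi.single v 1 := by
  have hinv := hω.symm (isClosedCone_tangent _ _)
  set κ := Function.invFunOn ω (tangent (lk Δ x) v) with hκ
  have hωκ : ∀ ζ ∈ cone (lk Δ x), ω (κ ζ) = ζ := fun ζ hζ =>
    Function.invFunOn_eq (hω.bijOn.surjOn hζ)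
  have hκω : ∀ u ∈ tangent (lk Δ x) v, κ (ω u) = u := fun u hu =>
    hω.bijOn.injOn.leftInvOn_invFunOn hu
  let q : (U → ℝ) → (U → ℝ) := fun z => κ (Function.update z x 0) + (c * z x) • Pi.single v 1
  let p : (U → ℝ) → (U → ℝ) := fun z => ω (q z) + z x • Pi.single x 1
  have hq : ∀ z ∈ tangent Δ x, q z ∈ tangent (lk Δ x) v := fun z hz =>
    (add_single_mem_tangent_iff _).2 (hinv.bijOn.mapsTo hz)
  have hωq : ∀ z ∈ tangent Δ x, ω (q z) ∈ cone (lk Δ x) := fun z hz => hω.bijOn.mapsTo (hq z hz)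
  have hpx : ∀ z ∈ tangent Δ x, p z x = z x := fun z hz => by
    simp [p, apply_eq_zero_of_mem_cone_lk (hωq z hz)]
  have hpT : ∀ z ∈ tangent Δ x, p z ∈ tangent Δ x := fun z hz =>
    (add_single_mem_tangent_iff _).2 (mem_tangent_of_mem_cone_lk (hωq z hz))
  have hp0 : ∀ z ∈ tangent Δ x, z x = 0 → p z = z := fun z hz h0 => by
    simp only [p, q, h0, mul_zero, zero_smul, add_zero]
    rw [hωκ _ hz, ← h0, Function.update_eq_self]
  have hpinj : InjOn p (tangent Δ x) := by
    intro y hy z hz hyz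
    have hx : y x = z x := by rw [← hpx y hy, ← hpx z hz, hyz]
    simp only [p, hx, add_left_inj] at hyz
    have h1 := hω.bijOn.injOn (hq y hy) (hq z hz) hyz
    simp only [q, hx, add_left_inj] at h1
    have h2 := hinv.bijOn.injOn hy hz h1
    rw [← update_zero_add_single y x, h2, hx, update_zero_add_single]
  have hpsurj : ∀ z ∈ tangent Δ x, ∃ y ∈ tangent Δ x, y x = z x ∧ p y = z := by
    intro z hz
    set u := κ (Function.update z x 0) + (-(c * z x)) • Pi.single v 1 with hu
    have huT : u ∈ tangent (lk Δ x) v :=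
      (add_single_mem_tangent_iff _).2 (hinv.bijOn.mapsTo hz)
    have hωu := hω.bijOn.mapsTo huT
    have hωux := apply_eq_zero_of_mem_cone_lk hωu
    have h1 : Function.update (ω u + z x • Pi.single x (1 : ℝ)) x 0 = ω u := by
      ext w
      rcases eq_or_ne w x with rfl | hw
      · simp [hωux]
      · simp [hw]
    have h2 : (ω u + z x • (Pi.single x 1 : U → ℝ)) x = z x := by simp [hωux]
    refine ⟨ω u + z x • Pi.single x 1, (add_single_mem_tangent_iff _).2
      (mem_tangent_of_mem_cone_lk hωu), h2, ?_⟩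
    simp only [p, q]
    rw [h1, h2, hκω u huT, hu, neg_smul, neg_add_cancel_right, hωκ _ hz, update_zero_add_single]
  have hpcont : ContinuousOn p (tangent Δ x) := by
    refine ContinuousOn.add (hω.continuousOn.comp (ContinuousOn.add ?_ (by fun_prop)) hq)
      (by fun_prop)
    exact hinv.continuousOn.comp (by fun_prop) fun z hz => hz
  have hpsmul : ∀ z ∈ tangent Δ x, ∀ t : ℝ, 0 ≤ t → p (t • z) = t • p z := by
    intro z hz t ht
    have h1 : q (t • z) = t • q z := by
      simp only [q]
      rw [← smul_zero t, Function.update_smul, hinv.map_smul _ hz t ht, smul_add, smul_smul,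
        Pi.smul_apply, smul_eq_mul, mul_left_comm, smul_zero]
    simp only [p]
    rw [h1, hω.map_smul _ (hq z hz) t ht, smul_add, smul_smul, Pi.smul_apply, smul_eq_mul]
  let h : (U → ℝ) → (U → ℝ) := fun z => if z ∈ tangent Δ x then p z else z
  have hhp : ∀ z ∈ tangent Δ x, h z = p z := fun z hz => if_pos hz
  have hh0 : ∀ z, z x = 0 → h z = z := by
    intro z hz
    by_cases hzT : z ∈ tangent Δ x
    · rw [hhp z hzT, hp0 z hzT hz]
    · exact if_neg hzT
  have hcases : ∀ z ∈ cone Δ, z x = 0 ∨ z ∈ tangent Δ x := fun z hz =>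
    (hz.1 x).eq_or_lt.imp Eq.symm (mem_tangent_of_mem_cone hz)
  have hhx : ∀ z ∈ cone Δ, h z x = z x := by
    intro z hz
    rcases hcases z hz with h0 | hT
    · rw [hh0 z h0]
    · rw [hhp z hT, hpx z hT]
  refine ⟨h, ⟨?_, ⟨?_, ?_, ?_⟩, ?_⟩, ?_⟩
  · have hU : cone Δ = (cone Δ ∩ tangent Δ x) ∪ (cone Δ ∩ {z | z x = 0}) := by
      rw [← inter_union_distrib_left, eq_comm, inter_eq_left]
      exact fun z hz => (hcases z hz).symm
    rw [hU]
    refine ContinuousOn.union_of_isClosed ?_ ?_ ?_ ?_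
    · exact (hpcont.mono inter_subset_right).congr fun z hz => hhp z hz.2
    · exact continuousOn_id.congr fun z hz => hh0 z hz.2
    · exact (isClosedCone_cone Δ).isClosed.inter (isClosedCone_tangent Δ x).isClosed
    · exact (isClosedCone_cone Δ).isClosed.inter
        (isClosed_eq (continuous_apply x) continuous_const)
  · intro z hz
    rcases hcases z hz with h0 | hT
    · rwa [hh0 z h0]
    · rw [hhp z hT]
      exact mem_cone_of_mem_tangent (hpT z hT) (by rw [hpx z hT]; exact hz.1 x)
  · intro y hy z hz hyz
    have hx : y x = z x := by rw [← hhx y hy, ← hhx z hz, hyz]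
    by_cases h0 : z x = 0
    · rwa [hh0 y (hx.trans h0), hh0 z h0] at hyz
    · have hzT := (hcases z hz).resolve_left h0
      have hyT := (hcases y hy).resolve_left (by rwa [hx])
      rw [hhp y hyT, hhp z hzT] at hyz
      exact hpinj hyT hzT hyz
  · intro z hz
    rcases hcases z hz with h0 | hT
    · exact ⟨z, hz, hh0 z h0⟩
    · obtain ⟨y, hy, hyx, rfl⟩ := hpsurj z hT
      exact ⟨y, mem_cone_of_mem_tangent hy (by rw [hyx]; exact hz.1 x), hhp y hy⟩
  · intro z hz t ht
    rcases hcases z hz with h0 | hT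
    · rw [hh0 z h0, hh0 _ (by simp [h0])]
    · rw [hhp z hT, hhp _ ((isClosedCone_tangent Δ x).smul_mem z hT t ht), hpsmul z hT t ht]
  · intro z hz hzv
    by_cases h0 : z x = 0
    · rw [hh0 z h0, h0, mul_zero, zero_smul, add_zero]
    have hzC := mem_cone_of_mem_tangent hz hzv
    have hzT := (hcases z hzC).resolve_left h0
    have hζ := update_zero_mem_tangent_lk hxv hz h0
    have hζv : Function.update z x 0 v = z v := Function.update_of_ne hxv.symm _ _
    have h1 : κ (Function.update z x 0) = Function.update z x 0 := by
      conv_lhs => rw [← hid _ hζ (by rwa [hζv])]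
      exact hκω _ hζ
    have h2 : 0 ≤ c * z x := mul_nonneg hc (hzC.1 x)
    rw [hhp z hzT]
    simp only [p, q]
    rw [h1, hid _ ((add_single_mem_tangent_iff _).2 hζ) (by simp [hxv.symm]; positivity),
      add_right_comm, update_zero_add_single]

/-- The tangent cone along `v` is homeomorphic to the whole cone, relative to the star of `v`. -/
theorem IsLinearSphere.exists_starIso (h : IsLinearSphere Δ n) (hv : {v} ∈ Δ) :
    ∃ ω : (U → ℝ) → (U → ℝ), IsConeIso ω (tangent Δ v) (cone Δ) ∧
      ∀ x ∈ tangent Δ v, 0 ≤ x v → ω x = x := by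
  induction n generalizing Δ v with
  | zero =>
    -- A complex with a vertex has a nonzero cone, which cannot inject into `ℝ⁰`.
    obtain ⟨φ, hφ⟩ := h.exists_chart
    have h1 : (Pi.single v 1 : U → ℝ) ∈ cone Δ := by simpa using single_mem_cone hv zero_le_one
    have h2 := hφ.isConeIso.bijOn.injOn h1 ((isClosedCone_cone Δ).zero_mem h1)
      (Subsingleton.elim _ _)
    simpa using congrFun h2 v
  | succ n ih =>
    obtain ⟨c, hc, Φ, hΦ, hΦid⟩ := h.exists_tangentIso hv
    -- One push for each vertex of `s`. On the star of `v` a push alters only the coordinate at `v`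
    -- and keeps it nonnegative, so the amounts add up.
    have hpush : ∀ s : Finset U, v ∉ s → ∃ g : (U → ℝ) → (U → ℝ), IsConeIso g (cone Δ) (cone Δ) ∧
        ∀ z ∈ tangent Δ v, 0 ≤ z v → g z = z + (c * ∑ w ∈ s, z w) • Pi.single v 1 := by
      intro s
      induction s using Finset.induction_on with
      | empty => exact fun _ => ⟨id, isConeIso_id, by simp⟩
      | insert x s hxs ihs =>
        intro hvs
        rw [Finset.mem_insert, not_or] at hvs
        obtain ⟨g, hg, hgv⟩ := ihs hvs.2
        have hone : ∃ f : (U → ℝ) → (U → ℝ), IsConeIso f (cone Δ) (cone Δ) ∧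
            ∀ z ∈ tangent Δ v, 0 ≤ z v → f z = z + (c * z x) • Pi.single v 1 := by
          by_cases hx : {v} ∈ lk Δ x
          · have hxΔ : {x} ∈ Δ := h.isLowerSet (by simp) hx.2
            obtain ⟨ω, hω, hid⟩ := ih (h.link hxΔ) hx
            exact exists_push (Ne.symm hvs.1) hω hid hc.le
          -- If `x` and `v` span no face, `z x` vanishes on the star of `v` and nothing is to be
          -- pushed.
          · refine ⟨id, isConeIso_id, fun z hz _ => ?_⟩
            have : z x = 0 := by
              by_contra h0
              exact hx (singleton_mem_lk h.isLowerSet (Ne.symm hvs.1) hz h0)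
            simp [this]
        obtain ⟨f, hf, hfv⟩ := hone
        refine ⟨f ∘ g, hf.comp hg, fun z hz hzv => ?_⟩
        have hz0 := fun w => (mem_cone_of_mem_tangent hz hzv).1 w
        have hs : 0 ≤ ∑ w ∈ s, z w := Finset.sum_nonneg fun w _ => hz0 w
        rw [Function.comp_apply, hgv z hz hzv, hfv _ ((add_single_mem_tangent_iff _).2 hz)
          (by simp; positivity), Finset.sum_insert hxs, add_assoc, ← add_smul]
        simp only [Pi.add_apply, Pi.smul_apply, Pi.single_apply, Ne.symm hvs.1, if_false,
          smul_zero, add_zero]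
        rw [mul_add, add_comm (c * z x)]
    obtain ⟨g, hg, hgv⟩ := hpush (Finset.univ.erase v) (by simp)
    -- On the star of `v`, `τ` agrees with `g` and lands where `Φ` is the identity. Hence `g⁻¹ ∘ Φ ∘
    -- τ` fixes the star.
    let τ : (U → ℝ) → (U → ℝ) := fun x => x + (c * height v x) • Pi.single v 1
    have hτ : IsConeIso τ (tangent Δ v) (tangent Δ v) := by
      refine ⟨?_, ⟨fun x hx => (add_single_mem_tangent_iff _).2 hx, fun x _ y _ hxy => ?_,
        fun y hy => ?_⟩, fun x _ t _ => ?_⟩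
      · have : Continuous (height v : (U → ℝ) → ℝ) := continuous_height
        simp only [τ]
        fun_prop
      · have h1 : height v x = height v y := by
          rw [← height_add_single (x := x) (c * height v x),
            ← height_add_single (x := y) (c * height v y)]
          exact congrArg _ hxy
        simpa only [τ, h1, add_left_inj] using hxy
      · refine ⟨y + (-(c * height v y)) • Pi.single v 1, (add_single_mem_tangent_iff _).2 hy, ?_⟩
        simp only [τ]
        rw [height_add_single, neg_smul, neg_add_cancel_right]
      · simp only [τ]
        rw [height_smul, smul_add, smul_smul, mul_left_comm]
    refine ⟨_, (hg.symm (isClosedCone_cone Δ)).comp (hΦ.comp hτ), fun x hx hxv => ?_⟩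
    have h1 : Φ (τ x) = g x := by
      rw [hΦid _ (hτ.bijOn.mapsTo hx), hgv x hx hxv]
      · rfl
      · simp only [τ]
        rw [height_add_single]
        simpa using hxv
    rw [Function.comp_apply, Function.comp_apply, h1]
    exact hg.bijOn.injOn.leftInvOn_invFunOn (mem_cone_of_mem_tangent hx hxv)

end SimplicialCone

/-! ### The antistar as a half-space -/

namespace SimplicialCone

open Set Filter Topology

theorem interior_halfBall (n : ℕ) :
    interior {q : (Fin n → ℝ) × ℝ | 0 ≤ q.2 ∧ ‖q‖ ≤ 1} = {q | 0 < q.2 ∧ ‖q‖ < 1} := by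
  have h1 : {q : (Fin n → ℝ) × ℝ | 0 ≤ q.2 ∧ ‖q‖ ≤ 1} =
      (univ ×ˢ Ici 0) ∩ Metric.closedBall 0 1 := by ext q; simp
  rw [h1, interior_inter, interior_prod_eq, interior_univ, interior_Ici,
    interior_closedBall _ one_ne_zero]
  ext q; simp

/-- The half-ball is a bounded closed convex set with interior, so it is homeomorphic to the unit
ball with frontier going to the sphere. -/
theorem exists_halfBall_homeomorph (n : ℕ) :
    ∃ h : {q : (Fin n → ℝ) × ℝ | 0 ≤ q.2 ∧ ‖q‖ ≤ 1} ≃ₜ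
      Metric.closedBall (0 : EuclideanSpace ℝ (Fin (n + 1))) 1,
      ∀ q, (h q : EuclideanSpace ℝ (Fin (n + 1))) ∈ Metric.sphere 0 1 ↔
        (q : (Fin n → ℝ) × ℝ).2 = 0 ∨ ‖(q : (Fin n → ℝ) × ℝ)‖ = 1 := by
  set Q : Set ((Fin n → ℝ) × ℝ) := {q | 0 ≤ q.2 ∧ ‖q‖ ≤ 1} with hQ
  let e : ((Fin n → ℝ) × ℝ) ≃L[ℝ] EuclideanSpace ℝ (Fin (n + 1)) :=
    ContinuousLinearEquiv.ofFinrankEq (by simp)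
  have hQc : IsClosed Q := by
    have h1 : Q = (univ ×ˢ Ici 0) ∩ Metric.closedBall 0 1 := by ext q; simp [hQ]
    rw [h1]
    exact (isClosed_univ.prod isClosed_Ici).inter Metric.isClosed_closedBall
  have hconv : Convex ℝ Q := by
    have h1 : Q = (univ ×ˢ Ici 0) ∩ Metric.closedBall 0 1 := by ext q; simp [hQ]
    rw [h1]
    exact (convex_univ.prod (convex_Ici 0)).inter (convex_closedBall _ _)
  have hbdd : Bornology.IsBounded Q :=
    (Metric.isBounded_closedBall (x := 0) (r := 1)).subset fun q hq => by simpa using hq.2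
  have hint : (interior (e '' Q)).Nonempty := by
    change (interior (e.toHomeomorph '' Q)).Nonempty
    rw [← Homeomorph.image_interior]
    refine Nonempty.image _ ⟨(0, 1 / 2), ?_⟩
    rw [interior_halfBall]
    constructor
    · norm_num
    · simp only [Prod.norm_mk, norm_zero]
      norm_num
  obtain ⟨g, -, hg2, hg3⟩ := exists_homeomorph_image_interior_closure_frontier_eq_unitBall
    (hconv.linear_image e.toLinearMap) hint
    (e.lipschitz.isBounded_image hbdd)
  let G := e.toHomeomorph.trans g
  have hGQ : G '' Q = Metric.closedBall 0 1 := by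
    rw [← hg2]
    change _ = g '' closure (e.toHomeomorph '' Q)
    rw [(e.toHomeomorph.isClosed_image.2 hQc).closure_eq]
    exact image_comp g e Q
  have hGf : G '' frontier Q = Metric.sphere 0 1 := by
    rw [← hg3]
    change _ = g '' frontier (e.toHomeomorph '' Q)
    rw [← Homeomorph.image_frontier]
    exact image_comp g e _
  refine ⟨(G.image Q).trans (Homeomorph.setCongr hGQ), fun q => ?_⟩
  change G q ∈ _ ↔ _
  rw [← hGf, G.injective.mem_set_image, frontier, hQc.closure_eq, interior_halfBall]
  obtain ⟨q, h1, h2⟩ := q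
  simp only [Set.mem_sdiff, mem_ofPred_eq, not_and_or, not_lt]
  constructor
  · rintro ⟨-, h | h⟩
    · exact Or.inl (le_antisymm h h1)
    · exact Or.inr (le_antisymm h2 h)
  · rintro (h | h)
    · exact ⟨⟨h1, h2⟩, Or.inl h.le⟩
    · exact ⟨⟨h1, h2⟩, Or.inr h.ge⟩

variable {U : Type*}

theorem mem_cone_antistar_iff [DecidableEq U] {Δ : Set (Finset U)} {v : U}
    (hΔ : IsLowerSet Δ) {z : U → ℝ} :
    z ∈ cone {F ∈ Δ | v ∉ F} ↔ z ∈ cone Δ ∧ z v = 0 := by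
  constructor
  · rintro ⟨h0, F, hF, h⟩
    exact ⟨⟨h0, F, hF.1, h⟩, h v hF.2⟩
  · rintro ⟨⟨h0, F, hF, h⟩, hv⟩
    refine ⟨h0, F.erase v, ⟨hΔ (Finset.erase_subset v F) hF, by simp⟩, fun w hw => ?_⟩
    rcases eq_or_ne w v with rfl | hwv
    · exact hv
    · exact h w fun h' => hw (Finset.mem_erase.2 ⟨hwv, h'⟩)

variable [Fintype U]

theorem sum_pos_of_ne_zero {Δ : Set (Finset U)} {z : U → ℝ} (hz : z ∈ cone Δ) (h : z ≠ 0) :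
    0 < ∑ w, z w := by
  refine (Finset.sum_nonneg fun w _ => hz.1 w).lt_of_ne fun h0 => h ?_
  ext w
  exact (Finset.sum_eq_zero_iff_of_nonneg fun w _ => hz.1 w).1 h0.symm w (Finset.mem_univ w)

/-- Any cone isomorphism can be rescaled so that the norm of the image is the sum of the
coordinates. -/
theorem IsConeIso.exists_norm_eq_sum {E : Type*} [NormedAddCommGroup E] [NormedSpace ℝ E]
    {Δ : Set (Finset U)} {B : Set E} {θ : (U → ℝ) → E} (hθ : IsConeIso θ (cone Δ) B)
    (hB : IsClosedCone B) :
    ∃ θ' : (U → ℝ) → E, IsConeIso θ' (cone Δ) B ∧ (∀ z ∈ cone Δ, ‖θ' z‖ = ∑ w, z w) ∧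
      ∀ z ∈ cone Δ, ∃ a : ℝ, 0 < a ∧ θ' z = a • θ z := by
  have hC := isClosedCone_cone Δ
  have h0 : ∀ z ∈ cone Δ, z ≠ 0 → 0 < ‖θ z‖ := fun z hz hz0 => by
    rw [norm_pos_iff, ← hθ.map_zero hz]
    exact fun h => hz0 (hθ.bijOn.injOn hz (hC.zero_mem hz) h)
  let θ' : (U → ℝ) → E := fun z => ((∑ w, z w) / ‖θ z‖) • θ z
  have hnorm : ∀ z ∈ cone Δ, ‖θ' z‖ = ∑ w, z w := by
    intro z hz
    rcases eq_or_ne z 0 with rfl | hz0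
    · simp [θ', hθ.map_zero hz]
    · have h1 := h0 z hz hz0
      have h2 := sum_pos_of_ne_zero hz hz0
      rw [norm_smul, Real.norm_of_nonneg (by positivity), div_mul_cancel₀ _ h1.ne']
  have hscale : ∀ z ∈ cone Δ, ∃ a : ℝ, 0 < a ∧ θ' z = a • θ z := by
    intro z hz
    rcases eq_or_ne z 0 with rfl | hz0
    · exact ⟨1, one_pos, by simp [θ', hθ.map_zero hz]⟩
    · exact ⟨_, div_pos (sum_pos_of_ne_zero hz hz0) (h0 z hz hz0), rfl⟩
  have hzero : θ' 0 = 0 := by simp [θ']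
  have hsmul : ∀ x ∈ cone Δ, ∀ t : ℝ, 0 ≤ t → θ' (t • x) = t • θ' x := by
    intro x hx t ht
    rcases ht.eq_or_lt with rfl | ht
    · simp [hzero]
    · simp only [θ', hθ.map_smul x hx t ht.le, norm_smul, Real.norm_of_nonneg ht.le, Pi.smul_apply,
        smul_eq_mul, ← Finset.mul_sum, smul_smul]
      rw [mul_div_mul_left _ _ ht.ne', mul_comm]
  refine ⟨θ', ⟨?_, ⟨?_, ?_, ?_⟩, hsmul⟩, hnorm, hscale⟩
  -- At the origin the quotient defining `θ'` gives no control; continuity comes from `‖θ' z‖` being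
  -- the coordinate sum.
  · intro z hz
    rcases eq_or_ne z 0 with rfl | hz0
    · rw [ContinuousWithinAt, hzero, tendsto_zero_iff_norm_tendsto_zero]
      have h1 : Tendsto (fun z : U → ℝ => ∑ w, z w) (𝓝[cone Δ] 0) (𝓝 0) := by
        have : Continuous fun z : U → ℝ => ∑ w, z w := by fun_prop
        simpa using (this.tendsto 0).mono_left nhdsWithin_le_nhds
      refine h1.congr' ?_
      filter_upwards [self_mem_nhdsWithin] with z hz using (hnorm z hz).symm
    · have hc := hθ.continuousOn z hz
      have h1 : ContinuousWithinAt (fun z : U → ℝ => ∑ w, z w) (cone Δ) z := by fun_prop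
      exact (h1.div hc.norm (h0 z hz hz0).ne').smul hc
  · intro z hz
    obtain ⟨a, ha, h⟩ := hscale z hz
    rw [h]
    exact hB.smul_mem _ (hθ.bijOn.mapsTo hz) a ha.le
  · intro y hy z hz hyz
    obtain ⟨a, ha, hya⟩ := hscale y hy
    obtain ⟨b, hb, hzb⟩ := hscale z hz
    have hs : ∑ w, y w = ∑ w, z w := by rw [← hnorm y hy, ← hnorm z hz, hyz]
    rw [hya, hzb, ← hθ.map_smul y hy a ha.le, ← hθ.map_smul z hz b hb.le] at hyz
    have h1 := hθ.bijOn.injOn (hC.smul_mem y hy a ha.le) (hC.smul_mem z hz b hb.le) hyz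
    -- Here `a • y = b • z`; since the coordinate sums agree, `a = b` unless `z = 0`.
    have h2 : a * ∑ w, y w = b * ∑ w, z w := by
      rw [Finset.mul_sum, Finset.mul_sum]
      exact Finset.sum_congr rfl fun w _ => congrFun h1 w
    rcases eq_or_ne z 0 with rfl | hz0
    · by_contra hy0
      have := sum_pos_of_ne_zero hy hy0
      simp [hs] at this
    · rw [hs] at h2
      have h3 := mul_right_cancel₀ (sum_pos_of_ne_zero hz hz0).ne' h2
      rw [h3] at h1
      exact smul_right_injective _ hb.ne' h1
  · intro q hq
    obtain ⟨z, hz, rfl⟩ := hθ.bijOn.surjOn hq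
    obtain ⟨a, ha, hza⟩ := hscale z hz
    exact ⟨a⁻¹ • z, hC.smul_mem z hz _ (by positivity), by
      rw [hsmul z hz _ (by positivity), hza, smul_smul, inv_mul_cancel₀ ha.ne', one_smul]⟩

variable [DecidableEq U] {Δ : Set (Finset U)} {v : U} {n : ℕ}

/-- The antistar of a vertex of a PL sphere is a ball, bounded by the link of the vertex. -/
theorem IsLinearSphere.exists_antistarIso (h : IsLinearSphere Δ (n + 1)) (hv : {v} ∈ Δ) :
    ∃ θ : (U → ℝ) → (Fin n → ℝ) × ℝ, IsConeIso θ (cone {F ∈ Δ | v ∉ F}) {q | 0 ≤ q.2} ∧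
      (∀ z ∈ cone {F ∈ Δ | v ∉ F}, ‖θ z‖ = ∑ w, z w) ∧
      ∀ z ∈ cone {F ∈ Δ | v ∉ F}, (θ z).2 = 0 ↔ z ∈ cone (lk Δ v) := by
  obtain ⟨ω, hω, hid⟩ := h.exists_starIso hv
  obtain ⟨φ, hφ⟩ := (h.link hv).exists_chart
  replace hφ := hφ.isConeIso
  have hΔ := h.isLowerSet
  have hinv := hω.symm (isClosedCone_tangent Δ v)
  set κ := Function.invFunOn ω (tangent Δ v) with hκ
  have hωκ : ∀ z ∈ cone Δ, ω (κ z) = z := fun z hz =>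
    Function.invFunOn_eq (hω.bijOn.surjOn hz)
  have hκω : ∀ u ∈ tangent Δ v, κ (ω u) = u := fun u hu =>
    hω.bijOn.injOn.leftInvOn_invFunOn hu
  have hκT : ∀ z ∈ cone Δ, κ z ∈ tangent Δ v := fun z hz => hinv.bijOn.mapsTo hz
  -- A positive coordinate would put `κ z` in the star, where `ω` is the identity, and force `z v >
  -- 0`.
  have hκv : ∀ z ∈ cone Δ, z v = 0 → κ z v ≤ 0 := by
    intro z hz hzv
    by_contra! hlt
    have h1 := hid _ (hκT z hz) hlt.le
    rw [hωκ z hz] at h1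
    rw [← h1, hzv] at hlt
    exact hlt.false
  have hpart : ∀ z ∈ cone {F ∈ Δ | v ∉ F}, z ∈ cone Δ ∧ z v = 0 :=
    fun z hz => (mem_cone_antistar_iff hΔ).1 hz
  let θ : (U → ℝ) → (Fin n → ℝ) × ℝ := fun z => (φ (Function.update (κ z) v 0), -κ z v)
  have hθ : IsConeIso θ (cone {F ∈ Δ | v ∉ F}) {q | 0 ≤ q.2} := by
    refine ⟨?_, ⟨?_, ?_, ?_⟩, ?_⟩
    · have hc : ContinuousOn κ (cone {F ∈ Δ | v ∉ F}) :=
        hinv.continuousOn.mono fun z hz => (hpart z hz).1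
      have h1 : ContinuousOn (fun z => κ z v) (cone {F ∈ Δ | v ∉ F}) :=
        (continuous_apply v).comp_continuousOn hc
      have h2 : Continuous fun u : U → ℝ => Function.update u v 0 := by fun_prop
      exact (hφ.continuousOn.comp (h2.comp_continuousOn hc) fun z hz =>
        hκT z (hpart z hz).1).prodMk h1.neg
    · intro z hz
      have := hκv z (hpart z hz).1 (hpart z hz).2
      simpa [θ] using this
    · intro y hy z hz hyz
      have hyC := (hpart y hy).1
      have hzC := (hpart z hz).1
      simp only [θ, Prod.mk.injEq, neg_inj] at hyz
      have h1 := hφ.bijOn.injOn (hκT y hyC) (hκT z hzC) hyz.1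
      have h2 : κ y = κ z := by
        rw [← update_zero_add_single (κ y) v, h1, hyz.2, update_zero_add_single]
      exact hinv.bijOn.injOn hyC hzC h2
    · rintro ⟨η, r⟩ hr
      replace hr : 0 ≤ r := hr
      obtain ⟨y, hy, rfl⟩ := hφ.bijOn.surjOn (mem_univ η)
      have hyv := apply_eq_zero_of_mem_cone_lk hy
      set u := y + (-r) • Pi.single v (1 : ℝ) with hu
      have huv : u v = -r := by simp [hu, hyv]
      have huT : u ∈ tangent Δ v :=
        (add_single_mem_tangent_iff _).2 (mem_tangent_of_mem_cone_lk hy)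
      have huC := hω.bijOn.mapsTo huT
      -- If `ω u` lay off the antistar, `ω` would fix it; injectivity would give `ω u = u`, but `u v
      -- = -r ≤ 0`.
      have hzero : ω u v = 0 := by
        by_contra hne
        have hpos : 0 < ω u v := (huC.1 v).lt_of_ne (Ne.symm hne)
        have hT := mem_tangent_of_mem_cone huC hpos
        have h1 := hω.bijOn.injOn hT huT (hid _ hT hpos.le)
        rw [h1, huv] at hpos
        linarith
      refine ⟨ω u, (mem_cone_antistar_iff hΔ).2 ⟨huC, hzero⟩, ?_⟩
      simp only [θ]
      rw [hκω u huT, huv, neg_neg]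
      have : Function.update u v 0 = y := by
        ext w
        rcases eq_or_ne w v with rfl | hw
        · simp [hyv]
        · simp [hu, hw]
      rw [this]
    · intro z hz t ht
      have hzC := (hpart z hz).1
      simp only [θ]
      rw [hinv.map_smul z hzC t ht, ← smul_zero t, Function.update_smul, smul_zero,
        hφ.map_smul _ (hκT z hzC) t ht]
      simp
  obtain ⟨θ', hθ', hnorm, hscale⟩ := hθ.exists_norm_eq_sum
    ⟨isClosed_le continuous_const continuous_snd, fun q hq t ht => mul_nonneg ht hq⟩
  refine ⟨θ', hθ', hnorm, fun z hz => ?_⟩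
  obtain ⟨hzC, -⟩ := hpart z hz
  obtain ⟨a, ha, hza⟩ := hscale z hz
  have h1 : (θ' z).2 = 0 ↔ κ z v = 0 := by simp [hza, θ, ha.ne']
  rw [h1]
  constructor
  · intro h0
    have h2 := hid _ (hκT z hzC) h0.ge
    rw [hωκ z hzC] at h2
    rw [h2]
    exact mem_cone_lk_of_mem_tangent (hκT z hzC) h0
  · intro hzl
    have hzv := apply_eq_zero_of_mem_cone_lk hzl
    have h2 := hκω z (mem_tangent_of_mem_cone_lk hzl)
    rw [hid z (mem_tangent_of_mem_cone_lk hzl) hzv.ge] at h2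
    rw [h2, hzv]

end SimplicialCone

/-! ### From PL spheres to linear spheres -/

namespace SimplicialCone

open Set Filter Topology

open PreAbstractSimplicialComplex

variable {V : Type*}

/-- The vertices of a complex. -/
abbrev Vertex (S : PreAbstractSimplicialComplex V) : Type _ := {w : V // {w} ∈ S.faces}

/-- The faces of `S`, including the empty one, as sets of vertices of `S`. -/
def augmentedFaces (S : PreAbstractSimplicialComplex V) : Set (Finset (Vertex S)) :=
  {G | G = ∅ ∨ G.map (Function.Embedding.subtype _) ∈ S.faces}

/-- Extension by zero of a vector indexed by the vertices of `S`. -/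
noncomputable abbrev ext (S : PreAbstractSimplicialComplex V) : (Vertex S → ℝ) →ₗ[ℝ] (V → ℝ) :=
  Function.ExtendByZero.linearMap ℝ Subtype.val

variable {S : PreAbstractSimplicialComplex V}

theorem ext_apply_coe (x : Vertex S → ℝ) (w : Vertex S) : ext S x w = x w :=
  Subtype.val_injective.extend_apply x (0 : V → ℝ) w

theorem ext_apply_of_notMem (x : Vertex S → ℝ) {w : V} (hw : {w} ∉ S.faces) : ext S x w = 0 :=
  Function.extend_apply' x (0 : V → ℝ) w fun ⟨u, hu⟩ => hw (hu ▸ u.2)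

theorem ext_injective : Function.Injective (ext S) := fun x y h => by
  ext w
  rw [← ext_apply_coe x, h, ext_apply_coe]

theorem continuous_ext : Continuous (ext S) := by
  refine continuous_pi fun w => ?_
  by_cases hw : {w} ∈ S.faces
  · simpa only [ext_apply_coe _ ⟨w, hw⟩] using
      continuous_apply (A := fun _ : Vertex S => ℝ) (⟨w, hw⟩ : Vertex S)
  · simpa only [ext_apply_of_notMem _ hw] using continuous_const

theorem singleton_mem_faces {F : Finset V} (hF : F ∈ S.faces) {w : V} (hw : w ∈ F) :
    {w} ∈ S.faces :=
  (S.isRelLowerSet_faces hF).2 (Finset.singleton_subset_iff.2 hw) (Finset.singleton_nonempty w)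

theorem exists_map_eq {F : Finset V} (hF : ∀ w ∈ F, {w} ∈ S.faces) :
    ∃ G : Finset (Vertex S), G.map (Function.Embedding.subtype _) = F := by
  classical
  exact ⟨F.subtype _, by rw [Finset.subtype_map, Finset.filter_true_of_mem hF]⟩

theorem isLowerSet_augmentedFaces : IsLowerSet (augmentedFaces S) := by
  intro F G hGF hF
  rcases G.eq_empty_or_nonempty with rfl | hG
  · exact Or.inl rfl
  · rcases hF with rfl | hF
    · exact absurd (Finset.subset_empty.1 hGF) hG.ne_empty
    · exact Or.inr ((S.isRelLowerSet_faces hF).2 (Finset.map_subset_map.2 hGF) (hG.map))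

theorem sum_map_ext (x : Vertex S → ℝ) (G : Finset (Vertex S)) :
    ∑ w ∈ G.map (Function.Embedding.subtype _), ext S x w = ∑ w ∈ G, x w := by
  rw [Finset.sum_map]
  exact Finset.sum_congr rfl fun w _ => ext_apply_coe x w

theorem ext_nonneg {x : Vertex S → ℝ} (hx : ∀ w, 0 ≤ x w) (w : V) : 0 ≤ ext S x w := by
  by_cases hw : {w} ∈ S.faces
  · rw [ext_apply_coe x ⟨w, hw⟩]
    exact hx _
  · rw [ext_apply_of_notMem x hw]

theorem ext_eq_zero {x : Vertex S → ℝ} {G : Finset (Vertex S)} (hx : ∀ w, w ∉ G → x w = 0)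
    {w : V} (hwG : w ∉ G.map (Function.Embedding.subtype _)) : ext S x w = 0 := by
  by_cases hw : {w} ∈ S.faces
  · rw [ext_apply_coe x ⟨w, hw⟩]
    exact hx _ fun h => hwG (Finset.mem_map_of_mem (Function.Embedding.subtype _) h)
  · rw [ext_apply_of_notMem x hw]

theorem mem_realization_iff {x : V → ℝ} : x ∈ S.realization ↔ ∃ F ∈ S.faces, x ∈ cell F := by
  simp [realization]

section Fintype

variable [Fintype (Vertex S)]

theorem ext_mem_realization {x : Vertex S → ℝ} (hx : x ∈ cone (augmentedFaces S))
    (h : ∑ w, x w = 1) : ext S x ∈ S.realization := by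
  obtain ⟨h0, G, hG, hxG⟩ := hx
  have hs : ∑ w ∈ G, x w = 1 := by
    rw [← h]
    exact Finset.sum_subset (Finset.subset_univ G) fun w _ hw => hxG w hw
  rcases hG with rfl | hG
  · simp at hs
  · exact mem_realization_iff.2 ⟨_, hG, ext_nonneg h0, fun w => ext_eq_zero hxG,
      by rw [sum_map_ext, hs]⟩

theorem exists_ext_eq {y : V → ℝ} (hy : y ∈ S.realization) :
    ∃ x ∈ cone (augmentedFaces S), ∑ w, x w = 1 ∧ ext S x = y := by
  obtain ⟨F, hF, h0, hyF, hs⟩ := mem_realization_iff.1 hy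
  obtain ⟨G, rfl⟩ := exists_map_eq (S := S) fun w hw => singleton_mem_faces hF hw
  have hG : ∀ w, w ∉ G → y w = 0 := fun w hw =>
    hyF w fun h => hw ((Finset.mem_map' _).1 h)
  refine ⟨fun w => y w, ⟨fun w => h0 w, G, Or.inr hF, hG⟩, ?_, ?_⟩
  · rw [← hs, Finset.sum_map]
    exact (Finset.sum_subset (Finset.subset_univ G) fun w _ hw => hG w hw).symm
  · ext w
    by_cases hw : {w} ∈ S.faces
    · exact ext_apply_coe _ ⟨w, hw⟩
    · rw [ext_apply_of_notMem _ hw, hyF w fun h => hw (singleton_mem_faces hF h)]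

theorem mem_realization_simplexBoundary_iff {d : ℕ} {y : Fin (d + 1) → ℝ} :
    y ∈ (simplexBoundary d).realization ↔ (∀ i, 0 ≤ y i) ∧ (∃ i, y i = 0) ∧ ∑ i, y i = 1 := by
  rw [mem_realization_iff]
  constructor
  · rintro ⟨F, ⟨-, hF⟩, h0, hyF, hs⟩
    obtain ⟨i, hi⟩ : ∃ i, i ∉ F := by
      by_contra! h
      exact hF (Finset.eq_univ_iff_forall.2 h)
    exact ⟨h0, ⟨i, hyF i hi⟩, by
      rw [← hs]; exact (Finset.sum_subset (Finset.subset_univ F) fun w _ hw => hyF w hw).symm⟩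
  · rintro ⟨h0, ⟨i, hi⟩, hs⟩
    have hsum : ∑ j ∈ Finset.univ.erase i, y j = 1 := by
      have := Finset.add_sum_erase Finset.univ y (Finset.mem_univ i)
      rwa [hi, zero_add, hs] at this
    refine ⟨Finset.univ.erase i, ⟨?_, ?_⟩, h0, ?_, hsum⟩
    · rw [Finset.nonempty_iff_ne_empty]
      intro h
      simp [h] at hsum
    · exact fun h => Finset.notMem_erase i Finset.univ (by rw [h]; exact Finset.mem_univ i)
    · intro w hw
      have : w = i := by simpa using hw
      rw [this, hi]

/-- The projection along the diagonal, in coordinates. -/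
def diagonalProj (d : ℕ) : (Fin (d + 1) → ℝ) →ₗ[ℝ] (Fin d → ℝ) :=
  LinearMap.pi fun i =>
    (LinearMap.proj i.succ : (Fin (d + 1) → ℝ) →ₗ[ℝ] ℝ) - LinearMap.proj 0

/-- Each line parallel to the diagonal meets the boundary of the nonnegative orthant in exactly one
point, reached by subtracting the minimal coordinate. -/
theorem bijOn_diagonalProj (d : ℕ) :
    BijOn (diagonalProj d) {y | (∀ i, 0 ≤ y i) ∧ ∃ i, y i = 0} univ := by
  have happ : ∀ y i, diagonalProj d y i = y i.succ - y 0 := fun y i => rfl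
  refine ⟨mapsTo_univ _ _, ?_, ?_⟩
  · rintro y ⟨hy0, i, hi⟩ z ⟨hz0, j, hj⟩ h
    have h1 : ∀ k, y k - y 0 = z k - z 0 := by
      intro k
      refine Fin.cases (by simp) (fun k => ?_) k
      have := congrFun h k
      rwa [happ, happ] at this
    have h2 := h1 i
    have h3 := h1 j
    have h4 := hz0 i
    have h5 := hy0 j
    ext k
    have := h1 k
    linarith
  · intro η _
    let y : Fin (d + 1) → ℝ := Fin.cons 0 η
    obtain ⟨i, hi⟩ := Finite.exists_min y
    refine ⟨fun k => y k - y i, ⟨fun k => sub_nonneg.2 (hi k), i, sub_self _⟩, ?_⟩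
    ext k
    rw [happ]
    simp [y]

/-- The homeomorphism is coned off from the origin, with image the boundary of the orthant, which
`diagonalProj` flattens onto `ℝᵈ`. -/
theorem isLinearSphere_of_isPLHomeomorphic {d : ℕ}
    (h : S.IsPLHomeomorphic (simplexBoundary d)) : IsLinearSphere (augmentedFaces S) d := by
  classical
  refine ⟨isLowerSet_augmentedFaces, Or.inl rfl, ?_⟩
  obtain ⟨f, K, hKfin, hKspace, -, hKA⟩ := h
  choose! A hA using hKA
  let F : (V → ℝ) → (Fin (d + 1) → ℝ) := fun y => if h : y ∈ S.realization then f ⟨y, h⟩ else 0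
  have hF : ∀ y (h : y ∈ S.realization), F y = f ⟨y, h⟩ := fun y h => dif_pos h
  have hFcont : ContinuousOn F S.realization := by
    rw [continuousOn_iff_continuous_domRestrict]
    have : S.realization.domRestrict F = fun y => (f y : Fin (d + 1) → ℝ) := by
      ext1 y
      exact hF y y.2
    rw [this]
    exact continuous_subtype_val.comp f.continuous
  set C := cone (augmentedFaces S) with hC
  have hCC : IsClosedCone C := isClosedCone_cone _
  let σ : (Vertex S → ℝ) →ₗ[ℝ] ℝ := ∑ w, LinearMap.proj w
  have hσ : ∀ x, σ x = ∑ w, x w := fun x => by simp [σ]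
  have hσpos : ∀ x ∈ C, x ≠ 0 → 0 < σ x := fun x hx h0 => by
    rw [hσ]; exact sum_pos_of_ne_zero hx h0
  have hσcont : Continuous σ := σ.continuous_of_finiteDimensional
  have hbase : ∀ x ∈ C, x ≠ 0 → (σ x)⁻¹ • ext S x ∈ S.realization := by
    intro x hx h0
    have h1 := hσpos x hx h0
    rw [← map_smul]
    refine ext_mem_realization (hCC.smul_mem x hx _ (by positivity)) ?_
    rw [← hσ, map_smul, smul_eq_mul, inv_mul_cancel₀ h1.ne']
  let ψ : (Vertex S → ℝ) → (Fin (d + 1) → ℝ) := fun x => σ x • F ((σ x)⁻¹ • ext S x)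
  have hψ0 : ψ 0 = 0 := by simp [ψ]
  let T : Set (Fin (d + 1) → ℝ) := {y | (∀ i, 0 ≤ y i) ∧ ∃ i, y i = 0}
  have hψT : ∀ x ∈ C, ψ x ∈ T ∧ ∑ i, ψ x i = σ x := by
    intro x hx
    rcases eq_or_ne x 0 with rfl | h0
    · rw [hψ0]
      exact ⟨⟨fun _ => le_rfl, 0, rfl⟩, by simp⟩
    · have h1 := hσpos x hx h0
      have h2 := hbase x hx h0
      obtain ⟨h3, ⟨i, hi⟩, h4⟩ := mem_realization_simplexBoundary_iff.1 (f ⟨_, h2⟩).2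
      simp only [ψ, hF _ h2, Pi.smul_apply, smul_eq_mul, ← Finset.mul_sum, h4, mul_one, and_true]
      exact ⟨fun j => mul_nonneg h1.le (h3 j), i, mul_eq_zero_of_right _ hi⟩
  have hψcont : ContinuousOn ψ C := by
    intro x hx
    rcases eq_or_ne x 0 with rfl | h0
    · rw [ContinuousWithinAt, hψ0]
      refine squeeze_zero_norm' (a := σ) ?_ ?_
      · filter_upwards [self_mem_nhdsWithin] with y hy
        obtain ⟨⟨h1, -⟩, h2⟩ := hψT y hy
        rw [← h2, pi_norm_le_iff_of_nonneg (Finset.sum_nonneg fun i _ => h1 i)]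
        intro i
        rw [Real.norm_of_nonneg (h1 i)]
        exact Finset.single_le_sum (fun j _ => h1 j) (Finset.mem_univ i)
      · simpa using (hσcont.tendsto 0).mono_left nhdsWithin_le_nhds
    · have h1 := hσpos x hx h0
      have h2 : ∀ᶠ y in 𝓝[C] x, y ≠ 0 :=
        (continuousAt_id.eventually_ne h0).filter_mono nhdsWithin_le_nhds
      have h3 : Tendsto (fun y => (σ y)⁻¹ • ext S y) (𝓝[C] x)
          (𝓝[S.realization] ((σ x)⁻¹ • ext S x)) := by
        refine tendsto_nhdsWithin_iff.2 ⟨?_, ?_⟩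
        · exact ((hσcont.continuousWithinAt.inv₀ h1.ne').smul
            continuous_ext.continuousWithinAt).tendsto
        · filter_upwards [h2, self_mem_nhdsWithin] with y hy hyC using hbase y hyC hy
      exact hσcont.continuousWithinAt.tendsto.smul ((hFcont _ (hbase x hx h0)).tendsto.comp h3)
  have hψsmul : ∀ x ∈ C, ∀ t : ℝ, 0 ≤ t → ψ (t • x) = t • ψ x := by
    intro x hx t ht
    rcases ht.eq_or_lt with rfl | ht
    · simp [hψ0]
    · have : (t * σ x)⁻¹ • t • ext S x = (σ x)⁻¹ • ext S x := by
        rw [smul_smul, mul_inv, mul_right_comm, inv_mul_cancel₀ ht.ne', one_mul]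
      simp only [ψ, map_smul, smul_eq_mul, this, mul_smul]
  have hψbij : BijOn ψ C T := by
    refine ⟨fun x hx => (hψT x hx).1, ?_, ?_⟩
    · intro x hx y hy hxy
      have hs : σ x = σ y := by rw [← (hψT x hx).2, ← (hψT y hy).2, hxy]
      rcases eq_or_ne x 0 with rfl | hx0
      · by_contra hy0
        have := hσpos y hy (Ne.symm hy0)
        simp [← hs] at this
      rcases eq_or_ne y 0 with rfl | hy0
      · have := hσpos x hx hx0
        simp [hs] at this
      have hpos := hσpos y hy hy0
      have hbx : (σ y)⁻¹ • ext S x ∈ S.realization := hs ▸ hbase x hx hx0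
      have hby := hbase y hy hy0
      simp only [ψ, hs] at hxy
      rw [hF _ hbx, hF _ hby] at hxy
      have h1 := f.injective (Subtype.ext (smul_right_injective _ hpos.ne' hxy))
      have h2 := congrArg Subtype.val h1
      exact ext_injective (smul_right_injective _ (inv_ne_zero hpos.ne') h2)
    · rintro y ⟨hy0, hi⟩
      have hCne : (0 : Vertex S → ℝ) ∈ C := ⟨fun _ => le_rfl, ∅, Or.inl rfl, fun _ _ => rfl⟩
      have hs : 0 ≤ ∑ i, y i := Finset.sum_nonneg fun i _ => hy0 i
      rcases hs.eq_or_lt with h0 | hpos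
      · refine ⟨0, hCne, ?_⟩
        rw [hψ0]
        ext i
        exact ((Finset.sum_eq_zero_iff_of_nonneg fun i _ => hy0 i).1 h0.symm i
          (Finset.mem_univ i)).symm
      · obtain ⟨i, hi⟩ := hi
        have hmem : (∑ i, y i)⁻¹ • y ∈ (simplexBoundary d).realization := by
          refine mem_realization_simplexBoundary_iff.2 ⟨fun j => ?_, ⟨i, ?_⟩, ?_⟩
          · exact mul_nonneg (by positivity) (hy0 j)
          · simp [hi]
          · simp only [Pi.smul_apply, smul_eq_mul, ← Finset.mul_sum]
            exact inv_mul_cancel₀ hpos.ne'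
        obtain ⟨x, hx, hx1, hxe⟩ := exists_ext_eq (f.symm ⟨_, hmem⟩).2
        refine ⟨(∑ i, y i) • x, hCC.smul_mem x hx _ hs, ?_⟩
        rw [hψsmul x hx _ hs]
        simp only [ψ, hσ, hx1, inv_one, one_smul]
        rw [hxe, hF _ (f.symm ⟨_, hmem⟩).2]
        simp [smul_smul, hpos.ne']
  have hT := bijOn_diagonalProj d
  -- Homogenizing the affine map `A s`, with its constant term multiplied by the coordinate sum `σ`,
  -- makes the coned map linear over `s`.
  let B : Finset (V → ℝ) → ((Vertex S → ℝ) →ₗ[ℝ] (Fin d → ℝ)) := fun s =>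
    diagonalProj d ∘ₗ ((A s).linear ∘ₗ ext S + σ.smulRight (A s 0))
  -- The map `0` is added to serve `x = 0`, since `K` may have no faces.
  refine ⟨fun x => diagonalProj d (ψ x), ⟨?_, hT.comp hψbij, ?_⟩, insert 0 (B '' K.faces),
    (hKfin.image B).insert 0, fun x hx => ?_⟩
  · exact (diagonalProj d).continuous_of_finiteDimensional.comp_continuousOn hψcont
  · intro x hx t ht
    rw [hψsmul x hx t ht, map_smul]
  · rcases eq_or_ne x 0 with rfl | h0
    · exact ⟨0, mem_insert _ _, by simp [hψ0]⟩
    · have h1 := hσpos x hx h0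
      have h2 := hbase x hx h0
      have h3 := h2
      rw [← hKspace, Geometry.SimplicialComplex.mem_space_iff] at h3
      obtain ⟨s, hs, hxs⟩ := h3
      refine ⟨B s, mem_insert_of_mem _ (mem_image_of_mem _ hs), ?_⟩
      have h4 := hA s hs ⟨_, h2⟩ hxs
      have h5 := congrFun (A s).decomp ((σ x)⁻¹ • ext S x)
      rw [Pi.add_apply] at h5
      simp only [ψ, B]
      rw [hF _ h2, h4]
      simp only [h5, LinearMap.comp_apply, LinearMap.add_apply, LinearMap.smulRight_apply,
        smul_add, map_smul, smul_smul, mul_inv_cancel₀ h1.ne', one_smul]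

end Fintype

end SimplicialCone

/-! ### The cone over the antistar is a ball with boundary `S` -/

namespace SimplicialCone

open Set Filter Topology

open PreAbstractSimplicialComplex

variable {V : Type*} {S : PreAbstractSimplicialComplex V}

theorem apply_apex {v : Vertex S} {z : Vertex S → ℝ}
    (hz : z ∈ cone {F ∈ augmentedFaces S | v ∉ F}) :
    z v = 0 := by
  obtain ⟨-, F, ⟨-, hF⟩, h⟩ := hz
  exact h v hF

variable [DecidableEq V]

/-- The cone with apex `v` over the antistar of the vertex `v` of `S`. -/
def coneOverAntistar (S : PreAbstractSimplicialComplex V) (v : V) :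
    PreAbstractSimplicialComplex V where
  faces := {F | F.Nonempty ∧ (F.erase v = ∅ ∨ F.erase v ∈ S.faces)}
  isRelLowerSet_faces := by
    rintro F ⟨hF, h⟩
    refine ⟨hF, fun G hGF hG => ⟨hG, ?_⟩⟩
    have hsub : G.erase v ⊆ F.erase v := Finset.erase_subset_erase v hGF
    rcases (G.erase v).eq_empty_or_nonempty with h0 | h0
    · exact Or.inl h0
    · rcases h with h | h
      · exact Or.inl (Finset.subset_empty.1 (h ▸ hsub))
      · exact Or.inr ((S.isRelLowerSet_faces h).2 hsub h0)

theorem finite_faces_coneOverAntistar (hS : S.faces.Finite) (v : V) :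
    (coneOverAntistar S v).faces.Finite := by
  refine ((hS.insert ∅).union ((hS.insert ∅).image (insert v))).subset ?_
  rintro F ⟨-, hF⟩
  by_cases hv : v ∈ F
  · exact Or.inr ⟨F.erase v, hF, Finset.insert_erase hv⟩
  · rw [Finset.erase_eq_of_notMem hv] at hF
    exact Or.inl hF

theorem faces_subset_coneOverAntistar (v : V) : S.faces ⊆ (coneOverAntistar S v).faces := by
  intro F hF
  refine ⟨(S.isRelLowerSet_faces hF).1, ?_⟩
  rcases (F.erase v).eq_empty_or_nonempty with h0 | h0
  · exact Or.inl h0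
  · exact Or.inr ((S.isRelLowerSet_faces hF).2 (Finset.erase_subset v F) h0)

/-- The coordinates of a point at the vertices of `S` other than `v`. -/
def dropApex (v : Vertex S) (x : V → ℝ) : Vertex S → ℝ := Function.update (fun w => x w) v 0

/-- The point of the cone over the antistar of `v` with given coordinates away from `v`. -/
noncomputable def joinApex [Fintype (Vertex S)] (v : Vertex S) (z : Vertex S → ℝ) : V → ℝ :=
  ext S z + (1 - ∑ w, z w) • Pi.single (v : V) 1

theorem continuous_dropApex (v : Vertex S) : Continuous (dropApex v) := by
  unfold dropApex
  fun_prop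

variable {v : Vertex S}

/-- Faces without `v` belong to the antistar. A face containing `v` lies in the boundary exactly
when it belongs to the star of `v` in `S`, as its barycenter detects. -/
theorem ballBoundary_coneOverAntistar {n : ℕ}
    {g : (coneOverAntistar S v).realization ≃ₜ
      Metric.closedBall (0 : EuclideanSpace ℝ (Fin n)) 1}
    (hg : ∀ x, (g x : EuclideanSpace ℝ (Fin n)) ∈ Metric.sphere 0 1 ↔
        (x : V → ℝ) v = 0 ∨ dropApex v x ∈ cone (lk (augmentedFaces S) v)) :
    ((coneOverAntistar S v).ballBoundary g).faces = S.faces := by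
  ext F
  constructor
  · rintro ⟨⟨hFne, hF⟩, hbd⟩
    by_cases hv : (v : V) ∈ F
    · have hcard : 0 < (F.card : ℝ) := by exact_mod_cast hFne.card_pos
      let x : V → ℝ := fun w => if w ∈ F then (F.card : ℝ)⁻¹ else 0
      have hx : x ∈ cell F := by
        refine ⟨fun w => ?_, fun w hw => if_neg hw, ?_⟩
        · simp only [x]
          split_ifs <;> positivity
        · rw [Finset.sum_congr rfl fun w hw => if_pos hw, Finset.sum_const, nsmul_eq_mul,
            mul_inv_cancel₀ hcard.ne']
      have hxR : x ∈ (coneOverAntistar S v).realization :=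
        mem_realization_iff.2 ⟨F, ⟨hFne, hF⟩, hx⟩
      have hxv : x v ≠ 0 := by simp [x, hv, hcard.ne']
      obtain ⟨-, G, ⟨-, hG⟩, hzero⟩ := ((hg ⟨x, hxR⟩).1 (hbd _ hx)).resolve_left hxv
      have hG' : (insert v G).map (Function.Embedding.subtype _) ∈ S.faces :=
        hG.resolve_left (Finset.insert_ne_empty v G)
      refine (S.isRelLowerSet_faces hG').2 (fun w hw => ?_) hFne
      rcases eq_or_ne w v with rfl | hwv
      · exact Finset.mem_map_of_mem (Function.Embedding.subtype _) (Finset.mem_insert_self v G)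
      · have hwe := Finset.mem_erase.2 ⟨hwv, hw⟩
        have hwS : {w} ∈ S.faces := by
          rcases hF with hF | hF
          · simp [hF] at hwe
          · exact singleton_mem_faces hF hwe
        have hwG : (⟨w, hwS⟩ : Vertex S) ∈ G := by
          by_contra hn
          have h1 := hzero _ hn
          have h2 : (⟨w, hwS⟩ : Vertex S) ≠ v := fun h => hwv (congrArg Subtype.val h)
          simp [dropApex, h2, x, hw, hcard.ne'] at h1
        exact Finset.mem_map_of_mem (Function.Embedding.subtype _)
          (Finset.mem_insert_of_mem hwG)
    · rw [Finset.erase_eq_of_notMem hv] at hF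
      exact hF.resolve_left hFne.ne_empty
  · intro hF
    refine ⟨faces_subset_coneOverAntistar _ hF, fun x hx => (hg x).2 ?_⟩
    by_cases hv : (v : V) ∈ F
    · obtain ⟨G, rfl⟩ := exists_map_eq (S := S) fun w hw => singleton_mem_faces hF hw
      have hvG : v ∈ G := (Finset.mem_map' (Function.Embedding.subtype _)).1 hv
      refine Or.inr ⟨fun w => ?_, G.erase v, ⟨by simp, ?_⟩, fun w hw => ?_⟩
      · rcases eq_or_ne w v with rfl | hw
        · simp [dropApex]
        · simpa [dropApex, hw] using hx.1 w
      · rw [Finset.insert_erase hvG]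
        exact Or.inr hF
      · rcases eq_or_ne w v with rfl | hwv
        · simp [dropApex]
        · have : w ∉ G := fun h => hw (Finset.mem_erase.2 ⟨hwv, h⟩)
          simp only [dropApex, ne_eq, hwv, not_false_eq_true, Function.update_of_ne]
          exact hx.2.1 w fun h => this ((Finset.mem_map' (Function.Embedding.subtype _)).1 h)
    · exact Or.inl (hx.2.1 v hv)

variable [Fintype (Vertex S)]

theorem continuous_joinApex : Continuous (joinApex v) := by
  have := continuous_ext (S := S)
  unfold joinApex
  fun_prop

variable (S v) in
/-- The coordinates away from `v` of the points of the cone over the antistar of `v`. -/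
def truncatedCone : Set (Vertex S → ℝ) :=
  {z | z ∈ cone {F ∈ augmentedFaces S | v ∉ F} ∧ ∑ w, z w ≤ 1}

theorem joinApex_mem_realization {z : Vertex S → ℝ} (hz : z ∈ truncatedCone S v) :
    joinApex v z ∈ (coneOverAntistar S v).realization := by
  obtain ⟨⟨h0, G, ⟨hG, hvG⟩, hzG⟩, hs⟩ := hz
  have hvG' : (v : V) ∉ G.map (Function.Embedding.subtype _) := fun h =>
    hvG ((Finset.mem_map' _).1 h)
  rw [mem_realization_iff]
  refine ⟨insert (v : V) (G.map (Function.Embedding.subtype _)), ⟨Finset.insert_nonempty _ _, ?_⟩,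
    ?_, ?_, ?_⟩
  · rw [Finset.erase_insert hvG']
    exact hG.imp_left fun h => by rw [h, Finset.map_empty]
  · intro w
    have h1 := ext_nonneg h0 w
    have h2 : 0 ≤ (1 - ∑ w, z w) * (Pi.single (v : V) (1 : ℝ) : V → ℝ) w := by
      refine mul_nonneg (sub_nonneg.2 hs) ?_
      rw [Pi.single_apply]
      split_ifs <;> norm_num
    exact add_nonneg h1 h2
  · intro w hw
    rw [Finset.mem_insert, not_or] at hw
    simp [joinApex, ext_eq_zero hzG hw.2, hw.1]
  · have hsum : ∑ w ∈ G, z w = ∑ w, z w :=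
      Finset.sum_subset (Finset.subset_univ G) fun w _ hw => hzG w hw
    rw [Finset.sum_insert hvG']
    have h1 : ∑ w ∈ G.map (Function.Embedding.subtype _), joinApex v z w = ∑ w, z w := by
      rw [← hsum, ← sum_map_ext]
      refine Finset.sum_congr rfl fun w hw => ?_
      have : w ≠ v := fun h => hvG' (h ▸ hw)
      simp [joinApex, this]
    rw [h1, joinApex, Pi.add_apply, ext_eq_zero hzG hvG']
    simp

theorem dropApex_joinApex {z : Vertex S → ℝ} (hz : z ∈ truncatedCone S v) :
    dropApex v (joinApex v z) = z := by
  ext w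
  rcases eq_or_ne w v with rfl | hw
  · simp [dropApex, apply_apex hz.1]
  · have : (w : V) ≠ v := fun h => hw (Subtype.ext h)
    simp only [dropApex, joinApex, ne_eq, hw, not_false_eq_true, Function.update_of_ne,
      Pi.add_apply, ext_apply_coe, Pi.smul_apply, Pi.single_apply, this, if_false, smul_zero,
      add_zero]

theorem dropApex_spec {x : V → ℝ} (hx : x ∈ (coneOverAntistar S v).realization) :
    dropApex v x ∈ truncatedCone S v ∧ ∑ w, dropApex v x w = 1 - x v ∧
      joinApex v (dropApex v x) = x := by
  obtain ⟨F, ⟨-, hF⟩, h0, hxF, hs⟩ := mem_realization_iff.1 hx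
  have hFS : ∀ w ∈ F.erase (v : V), {w} ∈ S.faces := by
    intro w hw
    rcases hF with hF | hF
    · simp [hF] at hw
    · exact singleton_mem_faces hF hw
  obtain ⟨G, hG⟩ := exists_map_eq hFS
  have hmem : ∀ w : Vertex S, w ∈ G ↔ (w : V) ∈ F.erase (v : V) := fun w => by
    rw [← hG]; exact (Finset.mem_map' (Function.Embedding.subtype _)).symm
  have hvG : v ∉ G := by simp [hmem]
  have hdrop : ∀ w : Vertex S, w ≠ v → dropApex v x w = x w := fun w hw => by
    simp [dropApex, hw]
  have hdropv : dropApex v x v = 0 := by simp [dropApex]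
  have hzero : ∀ w, w ∉ G → dropApex v x w = 0 := by
    intro w hw
    rcases eq_or_ne w v with rfl | hwv
    · exact hdropv
    · rw [hdrop w hwv]
      refine hxF w fun h => hw ((hmem w).2 (Finset.mem_erase.2 ⟨fun h' => hwv (Subtype.ext h'), h⟩))
  have hsum : ∑ w, dropApex v x w = 1 - x v := by
    have h1 : ∑ w, dropApex v x w = ∑ w ∈ F.erase (v : V), x w := by
      rw [← Finset.sum_subset (Finset.subset_univ G) fun w _ hw => hzero w hw, ← hG,
        Finset.sum_map]
      exact Finset.sum_congr rfl fun w hw => hdrop w fun h => hvG (h ▸ hw)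
    rw [h1, ← hs]
    by_cases hv : (v : V) ∈ F
    · rw [← Finset.add_sum_erase F x hv, add_sub_cancel_left]
    · rw [Finset.erase_eq_of_notMem hv, hxF v hv, sub_zero]
  refine ⟨⟨⟨fun w => ?_, G, ⟨?_, hvG⟩, hzero⟩, ?_⟩, hsum, ?_⟩
  · rcases eq_or_ne w v with rfl | hwv
    · exact hdropv.ge
    · rw [hdrop w hwv]
      exact h0 w
  · rcases hF with hF | hF
    · rw [hF, Finset.map_eq_empty] at hG
      exact Or.inl hG
    · exact Or.inr (by rwa [hG])
  · rw [hsum]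
    linarith [h0 v]
  · ext w
    rw [joinApex, hsum, sub_sub_cancel, Pi.add_apply]
    rcases eq_or_ne w v with rfl | hwv
    · rw [ext_apply_coe, hdropv]
      simp
    · by_cases hw : {w} ∈ S.faces
      · rw [ext_apply_coe _ ⟨w, hw⟩, hdrop _ fun h => hwv (congrArg Subtype.val h)]
        simp [hwv]
      · rw [ext_apply_of_notMem _ hw]
        have : x w = 0 := hxF w fun h => hw (hFS w (Finset.mem_erase.2 ⟨hwv, h⟩))
        simp [hwv, this]

/-- Forgetting the coordinate at the apex gives the part of the antistar cone with coordinate sum at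
most `1`, which `θ` maps onto a half-ball. The flat side corresponds to the link of `v`, the round
side to `x v = 0`. -/
theorem exists_ball_homeomorph {n : ℕ} (h : IsLinearSphere (augmentedFaces S) (n + 1))
    (v : Vertex S) :
    ∃ g : (coneOverAntistar S v).realization ≃ₜ
      Metric.closedBall (0 : EuclideanSpace ℝ (Fin (n + 1))) 1,
      ∀ x, (g x : EuclideanSpace ℝ (Fin (n + 1))) ∈ Metric.sphere 0 1 ↔
        (x : V → ℝ) v = 0 ∨ dropApex v x ∈ cone (lk (augmentedFaces S) v) := by
  have hv : {v} ∈ augmentedFaces S := Or.inr (by simpa using v.2)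
  obtain ⟨θ, hθ, hnorm, hbd⟩ := h.exists_antistarIso hv
  have hinv := hθ.symm (isClosedCone_cone _)
  set κ := Function.invFunOn θ (cone {F ∈ augmentedFaces S | v ∉ F})
  have hθκ : ∀ q ∈ {q : (Fin n → ℝ) × ℝ | 0 ≤ q.2}, θ (κ q) = q := fun q hq =>
    Function.invFunOn_eq (hθ.bijOn.surjOn hq)
  obtain ⟨b, hb⟩ := exists_halfBall_homeomorph n
  let e₁ : (coneOverAntistar S v).realization ≃ₜ truncatedCone S v :=
    { toFun := fun x => ⟨dropApex v x, (dropApex_spec x.2).1⟩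
      invFun := fun z => ⟨joinApex v z, joinApex_mem_realization z.2⟩
      left_inv := fun x => Subtype.ext (dropApex_spec x.2).2.2
      right_inv := fun z => Subtype.ext (dropApex_joinApex z.2)
      continuous_toFun := ((continuous_dropApex v).comp continuous_subtype_val).subtype_mk _
      continuous_invFun := (continuous_joinApex.comp continuous_subtype_val).subtype_mk _ }
  let e₂ : truncatedCone S v ≃ₜ {q : (Fin n → ℝ) × ℝ | 0 ≤ q.2 ∧ ‖q‖ ≤ 1} :=
    { toFun := fun z => ⟨θ z, hθ.bijOn.mapsTo z.2.1, (hnorm z z.2.1).trans_le z.2.2⟩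
      invFun := fun q => ⟨κ q, hinv.bijOn.mapsTo q.2.1, by
        rw [← hnorm _ (hinv.bijOn.mapsTo q.2.1), hθκ _ q.2.1]
        exact q.2.2⟩
      left_inv := fun z => Subtype.ext (hθ.bijOn.injOn.leftInvOn_invFunOn z.2.1)
      right_inv := fun q => Subtype.ext (hθκ _ q.2.1)
      continuous_toFun := (hθ.continuousOn.comp_continuous continuous_subtype_val
        fun z => z.2.1).subtype_mk _
      continuous_invFun := (hinv.continuousOn.comp_continuous continuous_subtype_val
        fun q => q.2.1).subtype_mk _ }
  refine ⟨(e₁.trans e₂).trans b, fun x => ?_⟩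
  obtain ⟨h1, h2, -⟩ := dropApex_spec x.2
  refine (hb _).trans ?_
  change (θ (dropApex v x)).2 = 0 ∨ ‖θ (dropApex v x)‖ = 1 ↔ _
  rw [hbd _ h1.1, hnorm _ h1.1, h2, or_comm, sub_eq_self]

end SimplicialCone

/-! ### Neighborly spheres are stacked -/

namespace PreAbstractSimplicialComplex

open SimplicialCone

theorem single_mem_cell {V : Type*} [DecidableEq V] (a : V) :
    (Pi.single a 1 : V → ℝ) ∈ cell {a} := by
  refine ⟨fun u => ?_, fun u hu => ?_, by simp⟩
  · rw [Pi.single_apply]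
    split_ifs <;> norm_num
  · have : u ≠ a := by simpa using hu
    simp [this]

theorem faces_eq_empty_of_isPLHomeomorphic_simplexBoundary_zero {V : Type*}
    {S : PreAbstractSimplicialComplex V} (h : S.IsPLHomeomorphic (simplexBoundary 0)) :
    S.faces = ∅ := by
  obtain ⟨f, -⟩ := h
  rw [Set.eq_empty_iff_forall_notMem]
  intro F hF
  obtain ⟨w, hw⟩ := (S.isRelLowerSet_faces hF).1
  classical
  have hx : (Pi.single w 1 : V → ℝ) ∈ S.realization := 
    mem_realization_iff.2 ⟨{w}, singleton_mem_faces hF hw, single_mem_cell w⟩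
  obtain ⟨G, ⟨hG, hG'⟩, -⟩ := mem_realization_iff.1 (f ⟨_, hx⟩).2
  obtain ⟨i, hi⟩ := hG
  refine hG' (Finset.eq_univ_iff_forall.2 fun j => ?_)
  rwa [Subsingleton.elim (α := Fin 1) j i]

theorem exists_vertex_of_isPLHomeomorphic {V : Type*} {S : PreAbstractSimplicialComplex V} {n : ℕ}
    (h : S.IsPLHomeomorphic (simplexBoundary (n + 1))) : Nonempty (Vertex S) := by
  obtain ⟨f, -⟩ := h
  have hx : (Pi.single 0 1 : Fin (n + 2) → ℝ) ∈ (simplexBoundary (n + 1)).realization := by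
    refine mem_realization_simplexBoundary_iff.2 ⟨fun i => ?_, ⟨1, by simp⟩, by simp⟩
    rw [Pi.single_apply]
    split_ifs <;> norm_num
  obtain ⟨F, hF, -⟩ := mem_realization_iff.1 (f.symm ⟨_, hx⟩).2
  obtain ⟨w, hw⟩ := (S.isRelLowerSet_faces hF).1
  exact ⟨⟨w, singleton_mem_faces hF hw⟩⟩

/-- The empty complex is the boundary of the zero-dimensional ball. -/
theorem isStackedSphere_zero {V : Type u} [Nonempty V] {S : PreAbstractSimplicialComplex V}
    (hS : S.faces = ∅) : S.IsStackedSphere 0 0 := by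
  obtain ⟨a⟩ := ‹Nonempty V›
  let B : PreAbstractSimplicialComplex V :=
    { faces := {{a}}
      isRelLowerSet_faces := by
        rintro F rfl
        exact ⟨Finset.singleton_nonempty a, fun G hG hne =>
          (Finset.subset_singleton_iff.1 hG).resolve_left hne.ne_empty⟩ }
  have hB : ∀ x ∈ B.realization, x ∈ cell {a} := by
    intro x hx
    obtain ⟨F, rfl, hF⟩ := mem_realization_iff.1 hx
    exact hF
  classical
  have ha : (Pi.single a 1 : V → ℝ) ∈ cell {a} := single_mem_cell a
  have haB : (Pi.single a 1 : V → ℝ) ∈ B.realization := mem_realization_iff.2 ⟨{a}, rfl, ha⟩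
  have huniq : ∀ x y : B.realization, x = y := by
    intro x y
    have hx := hB x x.2
    have hy := hB y y.2
    ext w
    by_cases hw : w = a
    · have h1 := hx.2.2
      have h2 := hy.2.2
      rw [Finset.sum_singleton] at h1 h2
      rw [hw, h1, h2]
    · rw [hx.2.1 w (by simpa using hw), hy.2.1 w (by simpa using hw)]
  let : Unique B.realization := ⟨⟨⟨_, haB⟩⟩, fun x => huniq x _⟩
  let : Unique (Metric.closedBall (0 : EuclideanSpace ℝ (Fin 0)) 1) :=
    ⟨⟨⟨0, by simp⟩⟩, fun x => Subtype.ext (Subsingleton.elim _ _)⟩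
  let h : B.realization ≃ₜ Metric.closedBall (0 : EuclideanSpace ℝ (Fin 0)) 1 :=
    Homeomorph.homeomorphOfUnique _ _
  refine ⟨V, Function.Embedding.refl V, B, h, Set.finite_singleton _, ?_, ?_⟩
  -- The bound would force `F` to be empty, so nothing is required of the only face, which is
  -- interior.
  · intro F hF hcard
    have : F = {a} := hF
    simp [this] at hcard
  · rw [hS, Set.image_empty, Set.eq_empty_iff_forall_notMem]
    rintro F ⟨hF, hbd⟩
    have h1 := hbd ⟨_, haB⟩ (by rw [show F = {a} from hF]; exact ha)
    rw [Subsingleton.elim (h ⟨_, haB⟩ : EuclideanSpace ℝ (Fin 0)) 0] at h1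
    simp at h1

/-- A `k`-neighborly PL sphere of dimension `d - 1` is `(d - k)`-stacked. -/
theorem isStackedSphere_of_isNeighborly {V : Type u} [Nonempty V]
    {S : PreAbstractSimplicialComplex V} {k d : ℕ} (hS : S.faces.Finite)
    (hPL : S.IsPLHomeomorphic (simplexBoundary d)) (hk : S.IsNeighborly k) (hkd : k ≤ d) :
    S.IsStackedSphere (d - k) d := by
  classical
  rcases d with _ | n
  · obtain rfl : k = 0 := Nat.le_zero.1 hkd
    exact isStackedSphere_zero (faces_eq_empty_of_isPLHomeomorphic_simplexBoundary_zero hPL)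
  have hfin : Finite (Vertex S) :=
    (hS.preimage (f := fun w : V => ({w} : Finset V)) (Finset.singleton_injective.injOn)).to_subtype
  let : Fintype (Vertex S) := Fintype.ofFinite _
  obtain ⟨v⟩ := exists_vertex_of_isPLHomeomorphic hPL
  obtain ⟨g, hg⟩ := exists_ball_homeomorph (isLinearSphere_of_isPLHomeomorphic hPL) v
  have hbd := ballBoundary_coneOverAntistar hg
  refine ⟨V, Function.Embedding.refl V, coneOverAntistar S v, g,
    finite_faces_coneOverAntistar hS v, fun F hF hcard => ?_, ?_⟩
  · rw [hbd]
    -- From `F.card + (d - k) ≤ d` and `k ≤ d` follows `F.card ≤ k`, and all vertices of `F` are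
    -- vertices of `S`.
    refine hk F hF.1 (by omega) fun w hw => ?_
    rcases eq_or_ne w v with rfl | hwv
    · exact v.2
    · have hwe := Finset.mem_erase.2 ⟨hwv, hw⟩
      rcases hF.2 with h | h
      · simp [h] at hwe
      · exact singleton_mem_faces h hwe
  · rw [hbd]
    ext F
    simp

theorem finite_faces_link {V : Type*} {M : PreAbstractSimplicialComplex V} (hM : M.faces.Finite)
    (a : V) : (M.link a).faces.Finite := by
  classical
  refine (hM.image fun F => F.erase a).subset ?_
  rintro F ⟨-, ha, hF⟩
  exact ⟨_, hF, by simp [Finset.cons_eq_insert, ha]⟩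

theorem IsNeighborly.link {V : Type*} {M : PreAbstractSimplicialComplex V} {k : ℕ}
    (hM : M.IsNeighborly (k + 1)) (a : V) (ha : {a} ∈ M.faces) : (M.link a).IsNeighborly k := by
  intro F hF hcard hv
  have haF : a ∉ F := fun h => by
    obtain ⟨-, h1, -⟩ := hv a h
    simp at h1
  refine ⟨hF, haF, hM _ (Finset.cons_nonempty haF) (by rw [Finset.card_cons]; omega) fun w hw => ?_⟩
  rcases Finset.mem_cons.1 hw with rfl | hw
  · exact ha
  · obtain ⟨-, h1, h2⟩ := hv w hw
    exact singleton_mem_faces h2 (by simp)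

end PreAbstractSimplicialComplex

theorem mainTheorem10 {V : Type*} (M : PreAbstractSimplicialComplex V) (k : ℕ) :
    (∀ d : ℕ, 2 * k ≤ d → M.IsCombinatorialManifold d → M.IsNeighborly (k + 1) →
      M.InClassK (d - k) d) ∧
    (M.IsCombinatorialManifold (2 * k) → M.IsNeighborly (k + 1) → M.InClassK k (2 * k)) := by
  have key : ∀ d : ℕ, 2 * k ≤ d → M.IsCombinatorialManifold d → M.IsNeighborly (k + 1) →
      M.InClassK (d - k) d := by
    rintro d hd ⟨hfin, hdim, hlink⟩ hk
    refine ⟨hfin, hdim, fun a ha => ?_⟩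
    -- For `d = 0` the ball is a single point, which needs a vertex.
    have : Nonempty V := ⟨a⟩
    exact PreAbstractSimplicialComplex.isStackedSphere_of_isNeighborly
      (PreAbstractSimplicialComplex.finite_faces_link hfin a) (hlink a ha) (hk.link a ha) (by omega)
  refine ⟨key, fun hM hk => ?_⟩
  have := key (2 * k) le_rfl hM hk
  rwa [show 2 * k - k = k by omega] at this
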